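/- **Setting.** Let $\Gamma(t)\subset\mathbb{R}^3$, $t\in[0,T]$, be a smoothly moving, closed (compact, without boundary), connected, smooth surface, oriented by a unit normal field $\nu(\cdot,t)$ that is continuous in space-time (for instance the outward one). Put $S_T=\bigcup_{t\in(0,T)}\Gamma(t)\times\{t\}$. Let $V_\Gamma^N$ be the scalar normal velocity of $\Gamma(t)$ in the direction $\nu$, and $H=-\mathrm{div}_\Gamma\nu$ (twice) the mean curvature. Let $\pi(\cdot,t)$ be the closest point mapping onto $\Gamma(t)$ and $d(\cdot,t)$ the signed distance from $\Gamma(t)$, increasing in the direction of $\nu$, so that $x=\pi(x,t)+d(x,t)\nu(\pi(x,t),t)$ near $\Gamma(t)$. For small $\varepsilon>0$ let $\Omega_\varepsilon(t)=\{x\in\mathbb{R}^3:\mathrm{dist}(x,\Gamma(t))<\varepsilon\}$, let $V_\varepsilon^N$ be the outward normal velocity of $\partial\Omega_\varepsilon(t)$, and let $\mathcal{H}^2$ be the two-dimensional Hausdorff measure (normalized to agree with surface area). **Theorem 5.3.** For all sufficiently small $\varepsilon>0$ let $u=u_\varepsilon$ (a vector field) and $p=p_\varepsilon$ (a scalar function)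 be such that, for every $t\in(0,T)$, $u(\cdot,t)$ is continuous on $\Omega_\varepsilon(t)$ and $p(\cdot,t)$ is continuous on $\overline{\Omega_\varepsilon(t)}$. Suppose that for $x\in\Omega_\varepsilon(t)$, $t\in(0,T)$, $$u(x,t)=v(\pi(x,t),t)+d(x,t)\,v^1(\pi(x,t),t)+R_u(x,t),\qquad p(x,t)=q(\pi(x,t),t)+d(x,t)\,q^1(\pi(x,t),t)+R_p(x,t),$$ where the coefficients $v,v^1,q,q^1$ are continuous on $S_T$ and independent of $\varepsilon$, and for every $[a,b]\subset(0,T)$ there is a constant $C$ independent of $\varepsilon$ such that, for all sufficiently small $\varepsilon$, $|R_u(x,t)|+|R_p(x,t)|\le C\,d(x,t)^2$ for all $t\in[a,b]$ and $x\in\Omega_\varepsilon(t)$. Suppose that for all sufficiently small $\varepsilon>0$ the bulk energy identity of the Euler equations holds: for every $t\in(0,T)$ the derivative on the left exists and $$\frac{d}{dt}\int_{\Omega_\varepsilon(t)}\frac{|u|^2}{2}\,dx=-\int_{\partial\Omega_\varepsilon(t)}p\,V_\varepsilon^N\,d\mathcal{H}^2 .$$ Then $v$, $q$ and $q^1$ satisfy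 the surface energy identity: for every $t\in(0,T)$ the derivative on the left exists and $$\frac{d}{dt}\int_{\Gamma(t)}\frac{|v|^2}{2}\,d\mathcal{H}^2=\int_{\Gamma(t)}(qH-q^1)\,V_\Gamma^N\,d\mathcal{H}^2 .$$ -/

import Mathlib

open MeasureTheory Set Filter Topology
open scoped ContDiff

/-- Three-dimensional Euclidean space. -/
abbrev E3 := EuclideanSpace ℝ (Fin 3)

/-- A smoothly moving, closed (compact, boundaryless), connected, oriented surface `Γ(t)` in `ℝ³`,
`t ∈ [0, T]`, with its unit normal field `ν(·, t)`.

Near each of its points the space-time set `⋃ Γ(t)`, `t ∈ [0, T]`, is the zero set of a smooth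
function `φ(t, x)` with nonvanishing spatial gradient (so that each `Γ(t)` is an embedded smooth
surface and moves smoothly, with finite normal velocity), and the orientation is given
by `ν = ∇ₓφ / |∇ₓφ|`.  Compactness of the space-time set makes each `Γ(t)` compact and prevents
pieces of the surface from appearing or disappearing. -/
structure OrientedMovingSurface (T : ℝ) where
  /-- the surface `Γ(t)` -/
  carrier : ℝ → Set E3
  /-- the unit normal `ν(y, t)`, written `normal t y`; only its values for `y ∈ Γ(t)` matter -/
  normal : ℝ → E3 → E3
  isCompact_spaceTime : IsCompact {z : ℝ × E3 | z.1 ∈ Icc 0 T ∧ z.2 ∈ carrier z.1}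
  isConnected : ∀ t ∈ Icc 0 T, IsConnected (carrier t)
  exists_defining_function : ∀ t₀ ∈ Icc 0 T, ∀ y₀ ∈ carrier t₀,
    ∃ φ : ℝ × E3 → ℝ, ContDiff ℝ ∞ φ ∧
      ∀ᶠ z in 𝓝 (t₀, y₀), z.1 ∈ Icc 0 T →
        (z.2 ∈ carrier z.1 ↔ φ z = 0) ∧
        gradient (fun x => φ (z.1, x)) z.2 ≠ 0 ∧
        (z.2 ∈ carrier z.1 →
          normal z.1 z.2 = ‖gradient (fun x => φ (z.1, x)) z.2‖⁻¹ •
            gradient (fun x => φ (z.1, x)) z.2)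

/-- The scalar normal velocity, at time `t` and at the point `y ∈ M(t)`, of a moving
hypersurface `M(t)` with unit normal `n(·, t)`: the common value of `γ'(t) ⬝ n(y, t)` over all
curves `γ` with `γ(s) ∈ M(s)` for `s` near `t` and `γ(t) = y`.  (The number is unique as soon
as one such curve exists.) -/
noncomputable def normalVelocity (M : ℝ → Set E3) (n : ℝ → E3 → E3) (t : ℝ) (y : E3) : ℝ :=
  Classical.epsilon fun c : ℝ =>
    ∀ γ : ℝ → E3, (∀ᶠ s in 𝓝 t, γ s ∈ M s) → γ t = y → DifferentiableAt ℝ γ t →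
      inner ℝ (deriv γ t) (n t y) = c

namespace OrientedMovingSurface

variable {T : ℝ} (Γ : OrientedMovingSurface T)

/-- The space-time hypersurface `S_T = ⋃_{t ∈ (0,T)} {t} × Γ(t)`. -/
def spaceTime : Set (ℝ × E3) := {z | z.1 ∈ Ioo 0 T ∧ z.2 ∈ Γ.carrier z.1}

/-- The normal velocity `V_Γ^N` of the moving surface. -/
noncomputable def surfaceVelocity (t : ℝ) (y : E3) : ℝ :=
  normalVelocity Γ.carrier Γ.normal t y

/-- The closest point mapping `π(·, t)` onto `Γ(t)`.  (The closest point is unique for `x` in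
a tubular neighbourhood of `Γ(t)`; elsewhere some closest point is chosen.) -/
noncomputable def closestPoint (t : ℝ) (x : E3) : E3 :=
  Classical.epsilon fun y => y ∈ Γ.carrier t ∧ dist x y = Metric.infDist x (Γ.carrier t)

/-- The signed distance `d(·, t)` from `Γ(t)`, increasing in the direction of `ν`; in a tubular
neighbourhood, `x = π(x, t) + d(x, t) ν(π(x, t), t)`. -/
noncomputable def signedDist (t : ℝ) (x : E3) : ℝ :=
  inner ℝ (x - Γ.closestPoint t x) (Γ.normal t (Γ.closestPoint t x))

/-- The tangential derivative `∂ᵢ^tan f = ∑ⱼ (δᵢⱼ - νᵢ νⱼ) ∂ⱼ f̃` on `Γ(t)` of a scalar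
function `f` on `Γ(t)`, with `f̃ = f ∘ π(·, t)` the constant extension in the normal direction. -/
noncomputable def tangentialPartial (t : ℝ) (f : E3 → ℝ) (i : Fin 3) (y : E3) : ℝ :=
  ∑ j : Fin 3, ((if i = j then 1 else 0) - Γ.normal t y i * Γ.normal t y j) *
    fderiv ℝ (fun x => f (Γ.closestPoint t x)) y (EuclideanSpace.single j 1)

/-- (Twice) the mean curvature `H = -div_Γ ν = -∑ᵢ ∂ᵢ^tan νᵢ` of `Γ(t)`. -/
noncomputable def meanCurvature (t : ℝ) (y : E3) : ℝ :=
  -∑ i : Fin 3, Γ.tangentialPartial t (fun z => Γ.normal t z i) i y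

/-- The moving thin domain `Ω_ε(t) = {x | dist(x, Γ(t)) < ε}`. -/
def thinDomain (ε t : ℝ) : Set E3 := Metric.thickening ε (Γ.carrier t)

/-- The unit outward normal `ν_ε` of `∂Ω_ε(t)`: it is `ν ∘ π` on the part of `∂Ω_ε(t)` where
`d = ε` and `-ν ∘ π` on the part where `d = -ε`. -/
noncomputable def thinDomainNormal (t : ℝ) (x : E3) : E3 :=
  if 0 < Γ.signedDist t x then Γ.normal t (Γ.closestPoint t x)
  else -Γ.normal t (Γ.closestPoint t x)

/-- The outward normal velocity `V_ε^N` of the moving boundary `∂Ω_ε(t)`. -/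
noncomputable def thinDomainVelocity (ε t : ℝ) (x : E3) : ℝ :=
  normalVelocity (fun s => frontier (Γ.thinDomain ε s)) Γ.thinDomainNormal t x

/-- `f(x, t) = g(π(x, t), t) + d(x, t) g¹(π(x, t), t) + R(d(x, t)²)` in `Ω_ε(t)` for small `ε`.
Here `f = f ε t x` may depend on `ε`, the coefficients `g`, `g¹` do not, and the remainder is
bounded by `C d(x, t)²` with `C` independent of `ε` and locally uniform in `t ∈ (0, T)`. -/
def HasNormalExpansion {F : Type*} [NormedAddCommGroup F] [NormedSpace ℝ F]
    (f : ℝ → ℝ → E3 → F) (g g1 : ℝ → E3 → F) : Prop :=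
  ∀ a b : ℝ, 0 < a → b < T → ∃ C : ℝ, ∀ᶠ ε in 𝓝[>] (0 : ℝ), ∀ t ∈ Icc a b,
    ∀ x ∈ Γ.thinDomain ε t,
      ‖f ε t x - (g t (Γ.closestPoint t x) + Γ.signedDist t x • g1 t (Γ.closestPoint t x))‖
        ≤ C * Γ.signedDist t x ^ 2

/-- The energy identity of the Euler equations in the moving thin domain,
`d/dt ∫_{Ω_ε(t)} |u|²/2 dx = -∫_{∂Ω_ε(t)} p V_ε^N dℋ²` for all `t ∈ (0, T)`. -/
def BulkEnergyIdentity (ε : ℝ) (u : ℝ → E3 → E3) (p : ℝ → E3 → ℝ) : Prop :=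
  ∀ t ∈ Ioo 0 T,
    HasDerivAt (fun s => ∫ x in Γ.thinDomain ε s, ‖u s x‖ ^ 2 / 2)
      (-∫ x in frontier (Γ.thinDomain ε t), p t x * Γ.thinDomainVelocity ε t x ∂μHE[2]) t

/-- The energy identity of the limit Euler equations on the moving surface,
`d/dt ∫_{Γ(t)} |v|²/2 dℋ² = ∫_{Γ(t)} (q H - q¹) V_Γ^N dℋ²` for all `t ∈ (0, T)`. -/
def SurfaceEnergyIdentity (v : ℝ → E3 → E3) (q q1 : ℝ → E3 → ℝ) : Prop :=
  ∀ t ∈ Ioo 0 T,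
    HasDerivAt (fun s => ∫ y in Γ.carrier s, ‖v s y‖ ^ 2 / 2 ∂μHE[2])
      (∫ y in Γ.carrier t,
        (q t y * Γ.meanCurvature t y - q1 t y) * Γ.surfaceVelocity t y ∂μHE[2]) t

end OrientedMovingSurface

/-! ### Euclidean Hausdorff measures and bi-Lipschitz maps -/

/-! Divide the bulk identity by the width `2 * ε` and let `ε` tend to zero. The rescaled bulk
energies converge to the surface energy at each time (`tendsto_energy`), and the rescaled fluxes,
which are their time derivatives, converge to the surface integral uniformly on compact time
intervals (`exists_flux_bound`). A pointwise limit whose derivatives converge locally uniformly is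
differentiable with the limiting derivative, so no time regularity of `v` is needed.

For the flux, `∂Ω_ε(t)` consists of the two parallel surfaces `y ± ε ν(y)`, whose outward normal
velocities are `± V_Γ^N` (`thinDomainVelocity_eq`). The displacement by `r` has area Jacobian `det(I
+ r W) = 1 + r tr W + O(r²)`, where `W` is the derivative of `ν ∘ π` and `tr W = -H`. On the
boundary `p = q ± ε q¹ + O(ε²)`. In the difference of the two sheets the terms of even order cancel,
and division by `2 * ε` leaves `q tr W + q¹ = -(q H - q¹)` up to `O(ε)`. The energy needs only the
leading order: `|u|²` differs from `|v ∘ π|²` by `O(ε)`, and the volume of the tube, pushed to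
`Γ(t)` by `π` and divided by `2 * ε`, tends to the area.

Areas are Hausdorff measures, so both measure statements (`IsTube.area_displace`,
`IsTube.eventually_map_proj`) come from bi-Lipschitz comparison. Near a point each map is compared
with its derivative up to a factor `κ > 1`, planar areas are reduced to volumes of prisms,
compactness globalizes the inequality, and finally `κ` tends to `1`.

Tubular coordinates come from the inverse function theorem applied to the normal displacement
together with the defining function. Doing this jointly in space and time gives radii and bounds
uniform on compact time intervals. -/

theorem finrank_E3 : Module.finrank ℝ E3 = 3 := by simp

theorem euclideanHausdorffMeasure_three : (μHE[3] : Measure E3) = volume :=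
  EuclideanSpace.euclideanHausdorffMeasure_eq_volume 3

/-- The hypothesis makes `f` constant on the fibres of `g` in `A`, so `f` factors through `g` by a
`K`-Lipschitz map. Comparing two images, rather than a set and its image, allows a nonlinear map to
be compared with its linearization. -/
theorem euclideanHausdorffMeasure_image_le {X Y Z : Type*} [MetricSpace X] [MeasurableSpace X]
    [BorelSpace X] [MetricSpace Y] [MeasurableSpace Y] [BorelSpace Y] (d : ℕ)
    {f : Z → X} {g : Z → Y} {A : Set Z} {K : NNReal}
    (h : ∀ y ∈ A, ∀ y' ∈ A, dist (f y) (f y') ≤ K * dist (g y) (g y')) :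
    μHE[d] (f '' A) ≤ (K : ENNReal) ^ d * μHE[d] (g '' A) := by
  rcases A.eq_empty_or_nonempty with rfl | ⟨z0, -⟩
  · simp
  have : Nonempty Z := ⟨z0⟩
  have hinv : ∀ y ∈ A, ∃ y' ∈ A, g y' = g y := fun y hy => ⟨y, hy, rfl⟩
  set s : Y → Z := Function.invFunOn g A with hs
  have hs1 : ∀ y ∈ A, s (g y) ∈ A ∧ g (s (g y)) = g y := fun y hy =>
    ⟨Function.invFunOn_mem (hinv y hy), Function.invFunOn_eq (hinv y hy)⟩
  have himg : (fun w => f (s w)) '' (g '' A) = f '' A := by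
    rw [image_image]
    apply image_congr
    intro y hy
    have h1 := h _ (hs1 y hy).1 y hy
    rw [(hs1 y hy).2, dist_self, mul_zero] at h1
    exact dist_le_zero.mp h1
  have hl : LipschitzOnWith K (fun w => f (s w)) (g '' A) := by
    refine LipschitzOnWith.of_dist_le_mul ?_
    rintro _ ⟨y, hy, rfl⟩ _ ⟨y', hy', rfl⟩
    have h1 := h _ (hs1 y hy).1 _ (hs1 y' hy').1
    rwa [(hs1 y hy).2, (hs1 y' hy').2] at h1
  have key := hl.hausdorffMeasure_image_le (d := d) (Nat.cast_nonneg d)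
  rw [himg, ENNReal.rpow_natCast] at key
  simp_rw [Measure.euclideanHausdorffMeasure_def, Measure.smul_apply, ENNReal.smul_def, smul_eq_mul]
  calc _ ≤ _ := mul_le_mul_right key _
    _ = _ := by ring

/-- A map with injective strict derivative `L` is locally `κ`-bi-Lipschitz equivalent to `L`. -/
theorem HasStrictFDerivAt.exists_nhds_dist_le {f : E3 → E3} {L : E3 →L[ℝ] E3} {a : E3}
    (hf : HasStrictFDerivAt f L a) (hL : Function.Injective L) {κ : NNReal} (hκ : 1 < κ) :
    ∃ U ∈ 𝓝 a, ∀ y ∈ U, ∀ y' ∈ U,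
      dist (f y) (f y') ≤ κ * dist (L y) (L y') ∧ dist (L y) (L y') ≤ κ * dist (f y) (f y') := by
  obtain ⟨c, hc, hcL⟩ : ∃ c > 0, ∀ v, c * ‖v‖ ≤ ‖L v‖ := by
    obtain ⟨K, hK, hKL⟩ := L.toLinearMap.exists_antilipschitzWith (LinearMap.ker_eq_bot.mpr hL)
    refine ⟨(K : ℝ)⁻¹, by positivity, fun v => ?_⟩
    have := hKL.le_mul_dist v 0
    simp only [map_zero, dist_zero_right] at this
    rw [inv_mul_le_iff₀ (by positivity)]
    exact this
  have hκ1 : (1 : ℝ) < κ := by exact_mod_cast hκ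
  have hκ0 : (0 : ℝ) < κ := by linarith
  -- With `c * ‖v‖ ≤ ‖L v‖`, this tolerance makes the linearization error at most `(1 - κ⁻¹) * ‖L (y
  -- - y')‖`. The two bounds then follow from `2 - κ⁻¹ ≤ κ` and `1 - (1 - κ⁻¹) = κ⁻¹`.
  have hη : 0 < c * (1 - (κ : ℝ)⁻¹) := mul_pos hc (by
    rw [sub_pos]; exact inv_lt_one_of_one_lt₀ hκ1)
  have h1 := (hasStrictFDerivAt_iff_isLittleO.mp hf).bound hη
  rw [nhds_prod_eq] at h1
  obtain ⟨U, hU, hUb⟩ := mem_prod_same_iff.mp h1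
  refine ⟨_, hU, fun y hy y' hy' => ?_⟩
  have h2 := hUb (mk_mem_prod hy hy')
  simp only [mem_ofPred_eq] at h2
  simp only [dist_eq_norm, ← map_sub]
  have h3 := hcL (y - y')
  set w := ‖L (y - y')‖
  have h4 : ‖f y - f y' - L (y - y')‖ ≤ (1 - (κ : ℝ)⁻¹) * w := by
    refine h2.trans ?_
    rw [mul_comm c, mul_assoc]
    exact mul_le_mul_of_nonneg_left h3 (by
      rw [sub_nonneg]; exact inv_le_one_of_one_le₀ hκ1.le)
  have h5 := norm_sub_norm_le (f y - f y') (L (y - y'))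
  have h6 := norm_sub_norm_le (L (y - y')) (f y - f y')
  rw [norm_sub_rev (L (y - y'))] at h6
  have hw : 0 ≤ w := norm_nonneg _
  have h7 : (κ : ℝ) * (κ : ℝ)⁻¹ = 1 := mul_inv_cancel₀ hκ0.ne'
  constructor
  · have : 2 - (κ : ℝ)⁻¹ ≤ κ := by
      have : 0 ≤ (κ : ℝ)⁻¹ * (κ - 1) ^ 2 := by positivity
      nlinarith
    nlinarith
  · have : (κ : ℝ)⁻¹ * w ≤ ‖f y - f y'‖ := by linarith
    calc w = κ * ((κ : ℝ)⁻¹ * w) := by rw [← mul_assoc, h7, one_mul]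
      _ ≤ _ := by gcongr

/-! ### The tangential projection and volumes of prisms -/

/-- The orthogonal projection along the unit vector `n`. -/
noncomputable def tangentProj (n : E3) : E3 →L[ℝ] E3 :=
  ContinuousLinearMap.id ℝ E3 - (innerSL ℝ n).smulRight n

theorem tangentProj_apply (n v : E3) : tangentProj n v = v - inner ℝ n v • n := by
  simp [tangentProj]

theorem inner_tangentProj {n : E3} (hn : ‖n‖ = 1) (v : E3) : inner ℝ n (tangentProj n v) = 0 := by
  rw [tangentProj_apply, inner_sub_right, inner_smul_right, real_inner_self_eq_norm_sq, hn]; ring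

theorem tangentProj_of_inner_eq_zero {n v : E3} (h : inner ℝ n v = 0) : tangentProj n v = v := by
  rw [tangentProj_apply, h, zero_smul, sub_zero]

/-- The right prism of height `(a, b)` in direction `n` over `S`. -/
def prism (n : E3) (S : Set E3) (a b : ℝ) : Set E3 :=
  {x | tangentProj n x ∈ S ∧ inner ℝ n x ∈ Ioo a b}

/-- Fubini: the slices orthogonal to `n` are translates of `S`. This is the bridge from planar area
to volume, for which linear maps are known to scale by the determinant. -/
theorem volume_prism {n : E3} (hn : ‖n‖ = 1) {S : Set E3} (hS : MeasurableSet S)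
    (hS0 : ∀ x ∈ S, inner ℝ n x = 0) (a b : ℝ) :
    volume (prism n S a b) = ENNReal.ofReal (b - a) * μHE[2] S := by
  have hmeas : MeasurableSet (prism n S a b) :=
    ((tangentProj n).continuous.measurable hS).inter
      ((innerSL ℝ n).continuous.measurable measurableSet_Ioo)
  have hn0 : n ≠ 0 := by
    rintro rfl
    simp at hn
  have key := EuclideanGeometry.euclideanHausdorffMeasure_eq_lintegral (0 : E3) hn0 hmeas
  rw [finrank_E3, euclideanHausdorffMeasure_three] at key
  have hslice : ∀ x : ℝ, μHE[3 - 1] (prism n S a b ∩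
      (AffineSubspace.mk' (x • n +ᵥ (0 : E3)) (Submodule.span ℝ {n})ᗮ : AffineSubspace ℝ E3)) =
      (Ioo a b).indicator (fun _ => μHE[2] S) x := by
    intro x
    have hmem : ∀ y : E3, y ∈ AffineSubspace.mk' (x • n +ᵥ (0 : E3)) (Submodule.span ℝ {n})ᗮ ↔
        inner ℝ n y = x := by
      intro y
      rw [AffineSubspace.mem_mk', Submodule.mem_orthogonal_singleton_iff_inner_right]
      simp only [vadd_eq_add, add_zero, vsub_eq_sub, inner_sub_right, inner_smul_right,
        real_inner_self_eq_norm_sq, hn]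
      rw [sub_eq_zero]; simp
    by_cases hx : x ∈ Ioo a b
    · rw [indicator_of_mem hx]
      have : prism n S a b ∩
          (AffineSubspace.mk' (x • n +ᵥ (0 : E3)) (Submodule.span ℝ {n})ᗮ : AffineSubspace ℝ E3) =
          (fun y => x • n + y) '' S := by
        ext y
        simp only [mem_inter_iff, SetLike.mem_coe, hmem, prism, mem_ofPred_eq, mem_image]
        constructor
        · rintro ⟨⟨h1, -⟩, h3⟩
          refine ⟨_, h1, ?_⟩
          rw [tangentProj_apply, h3]; abel
        · rintro ⟨z, hz, rfl⟩
          have h1 : inner ℝ n (x • n + z) = x := by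
            rw [inner_add_right, inner_smul_right, real_inner_self_eq_norm_sq, hn, hS0 z hz]; simp
          refine ⟨⟨?_, by rw [h1]; exact hx⟩, h1⟩
          rw [tangentProj_apply, h1, add_sub_cancel_left]; exact hz
      rw [this]
      exact Isometry.euclideanHausdorffMeasure_image (isometry_add_left (x • n)) S
    · rw [indicator_of_notMem hx]
      convert measure_empty (μ := (μHE[2] : Measure E3))
      rw [eq_empty_iff_forall_notMem]
      rintro y ⟨hy1, hy2⟩
      rw [SetLike.mem_coe, hmem] at hy2
      exact hx (hy2 ▸ hy1.2)
  rw [key]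
  simp_rw [hslice]
  rw [lintegral_indicator measurableSet_Ioo, lintegral_const, Measure.restrict_apply_univ,
    Real.volume_Ioo, mul_comm (μHE[2] S)]
  have : ‖n‖ₑ = 1 := by rw [← ofReal_norm, hn]; simp
  rw [this, one_mul]

theorem euclideanHausdorffMeasure_two_lt_top {n : E3} (hn : ‖n‖ = 1) {S : Set E3}
    (hS0 : ∀ x ∈ S, inner ℝ n x = 0) (hb : Bornology.IsBounded S) : μHE[2] S < ⊤ := by
  -- `S` is not assumed measurable, whereas its closure is, and the closure stays in the plane.
  have hS0c : ∀ x ∈ closure S, inner ℝ n x = 0 := by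
    have : IsClosed {x : E3 | inner ℝ n x = 0} :=
      isClosed_eq (innerSL ℝ n).continuous continuous_const
    exact fun x hx => closure_minimal hS0 this hx
  have h := volume_prism hn (S := closure S) isClosed_closure.measurableSet hS0c 0 1
  simp only [sub_zero, ENNReal.ofReal_one, one_mul] at h
  refine (measure_mono subset_closure).trans_lt ?_
  rw [← h]
  refine Bornology.IsBounded.measure_lt_top ?_
  obtain ⟨R, hR⟩ := (Metric.isBounded_iff_subset_closedBall 0).mp hb.closure
  refine (Metric.isBounded_iff_subset_closedBall 0).mpr ⟨R + 1, fun x hx => ?_⟩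
  have h1 := hR hx.1
  rw [mem_closedBall_zero_iff] at h1 ⊢
  have h2 : x = tangentProj n x + inner ℝ n x • n := by rw [tangentProj_apply]; abel
  rw [h2]
  refine (norm_add_le _ _).trans (add_le_add h1 ?_)
  rw [norm_smul, hn, mul_one, Real.norm_eq_abs, abs_le]
  exact ⟨by linarith [hx.2.1], hx.2.2.le⟩

/-- Area scaling of a linear map that fixes `n` and preserves the plane orthogonal to `n`. -/
theorem euclideanHausdorffMeasure_two_image_linear {n : E3} (hn : ‖n‖ = 1) {L : E3 →L[ℝ] E3}
    (hL : Function.Injective L) (hLn : L n = n) (hL0 : ∀ v, inner ℝ n (L v) = inner ℝ n v)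
    {S : Set E3} (hS : MeasurableSet S) (hS0 : ∀ x ∈ S, inner ℝ n x = 0) :
    μHE[2] (L '' S) = ENNReal.ofReal |LinearMap.det (L : E3 →ₗ[ℝ] E3)| * μHE[2] S := by
  have h1 := volume_prism hn hS hS0 0 1
  have hLS : MeasurableSet (L '' S) :=
    hS.image_of_continuousOn_injOn L.continuous.continuousOn hL.injOn
  have h2 := volume_prism hn hLS (by
    rintro _ ⟨x, hx, rfl⟩
    rw [hL0, hS0 x hx]) 0 1
  -- `L` commutes with the tangential projection and preserves height. Since a prism of height one
  -- has volume equal to the area of its base, the area factor of `L` is its volume factor.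
  have h3 : prism n (L '' S) 0 1 = L '' prism n S 0 1 := by
    have hcomm : ∀ x, tangentProj n (L x) = L (tangentProj n x) := by
      intro x
      rw [tangentProj_apply, tangentProj_apply, hL0, map_sub, map_smul, hLn]
    have hsurj : Function.Surjective L :=
      (LinearMap.injective_iff_surjective (f := L.toLinearMap)).mp hL
    ext y
    obtain ⟨x, rfl⟩ := hsurj y
    simp only [prism, mem_ofPred_eq, hcomm, hL0, hL.mem_set_image]
  rw [h3, Measure.addHaar_image_continuousLinearMap, h1] at h2
  simpa using h2.symm

/-! ### Localization on compact sets -/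

/-- Subadditivity of `m` and superadditivity of `k` on disjoint measurable sets let the inequality
pass from two pieces to their union. Measurable covering sets are carried through the compactness
induction so that `A` can be split. The index keeps the conclusion uniform in `A` for each small
`ε`. -/
theorem IsCompact.eventually_le_of_locally_le {ι : Type*} {l : Filter ι} {M : Set E3}
    (hM : IsCompact M) {m k : ι → Set E3 → ENNReal}
    (hm0 : ∀ i, m i ∅ = 0)
    (hm : ∀ i A B, m i (A ∪ B) ≤ m i A + m i B)
    (hk : ∀ i, ∀ A ⊆ M, ∀ B ⊆ M, MeasurableSet A → MeasurableSet B → Disjoint A B →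
      k i A + k i B ≤ k i (A ∪ B))
    (hloc : ∀ y ∈ M, ∃ U ∈ 𝓝 y, ∀ᶠ i in l, ∀ A ⊆ U ∩ M, MeasurableSet A → m i A ≤ k i A) :
    ∀ᶠ i in l, ∀ A ⊆ M, MeasurableSet A → m i A ≤ k i A := by
  suffices H : ∃ S, MeasurableSet S ∧ M ⊆ S ∧
      ∀ᶠ i in l, ∀ A ⊆ S ∩ M, MeasurableSet A → m i A ≤ k i A by
    obtain ⟨S, -, hMS, hS⟩ := H
    filter_upwards [hS] with i hi A hA using hi A (subset_inter (hA.trans hMS) hA)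
  refine hM.induction_on (p := fun s => ∃ S, MeasurableSet S ∧ s ⊆ S ∧
      ∀ᶠ i in l, ∀ A ⊆ S ∩ M, MeasurableSet A → m i A ≤ k i A) ?_ ?_ ?_ ?_
  · refine ⟨∅, MeasurableSet.empty, subset_rfl, Eventually.of_forall fun i A hA _ => ?_⟩
    have : A = ∅ := by simpa using hA
    rw [this, hm0]; exact zero_le
  · rintro s t hst ⟨S, h1, h2, h3⟩
    exact ⟨S, h1, hst.trans h2, h3⟩
  · rintro s t ⟨S, h1, h2, h3⟩ ⟨S', h1', h2', h3'⟩
    refine ⟨S ∪ S', h1.union h1', union_subset_union h2 h2', ?_⟩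
    filter_upwards [h3, h3'] with i hi hi' A hA hAm
    have e : A = (A ∩ S) ∪ (A \ S) := (inter_union_sdiff A S).symm
    have hAM : A ⊆ M := fun x hx => (hA hx).2
    have b1 := hi (A ∩ S) (fun x hx => ⟨hx.2, hAM hx.1⟩) (hAm.inter h1)
    have b2 := hi' (A \ S) (fun x hx => ⟨((hA hx.1).1.resolve_left hx.2), hAM hx.1⟩) (hAm.diff h1)
    calc m i A = m i ((A ∩ S) ∪ (A \ S)) := by rw [← e]
      _ ≤ _ := hm _ _ _
      _ ≤ k i (A ∩ S) + k i (A \ S) := add_le_add b1 b2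
      _ ≤ k i ((A ∩ S) ∪ (A \ S)) := hk i _ (inter_subset_left.trans hAM) _
          (sdiff_subset.trans hAM) (hAm.inter h1) (hAm.diff h1) disjoint_inf_sdiff
      _ = k i A := by rw [← e]
  · intro y hy
    obtain ⟨U, hU, h⟩ := hloc y hy
    obtain ⟨V, hVU, hV, hyV⟩ := mem_nhds_iff.mp hU
    exact ⟨V, mem_nhdsWithin_of_mem_nhds (hV.mem_nhds hyV), V, hV.measurableSet, subset_rfl,
      h.mono fun i hi A hA => hi A (hA.trans (inter_subset_inter_left _ hVU))⟩

theorem IsCompact.exists_radius {X : Type*} [PseudoMetricSpace X] {K : Set X} (hK : IsCompact K)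
    {Q : X → Prop} (h : ∀ z ∈ K, ∀ᶠ z' in 𝓝 z, Q z') :
    ∃ ρ > 0, ∀ z ∈ K, ∀ z', dist z' z < ρ → Q z' := by
  obtain ⟨ρ, hρ, hsub⟩ := hK.exists_thickening_subset_open (t := interior {z | Q z}) isOpen_interior
    (fun z hz => mem_interior_iff_mem_nhds.mpr (h z hz))
  exact ⟨ρ, hρ, fun z hz z' hz' =>
    interior_subset (hsub (Metric.mem_thickening_iff.mpr ⟨z, hz, hz'⟩))⟩

/-! ### Tubular neighbourhoods of a fixed surface -/

/-- The compact set `M` has the unit normal field `n`, and on the tube of radius `ρ` about `M` the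
closest point mapping `P` is single valued, with `C¹` regularity along `M`; the radius is small
compared with the curvature. -/
structure IsTube (M : Set E3) (n P : E3 → E3) (ρ : ℝ) : Prop where
  isCompact : IsCompact M
  pos : 0 < ρ
  proj_mem : ∀ x, P x ∈ M
  dist_proj : ∀ x, dist x (P x) = Metric.infDist x M
  norm_normal : ∀ y ∈ M, ‖n y‖ = 1
  proj_add : ∀ y ∈ M, ∀ r : ℝ, |r| < ρ → P (y + r • n y) = y
  decomp : ∀ x, Metric.infDist x M < ρ → x = P x + (inner ℝ (x - P x) (n (P x)) : ℝ) • n (P x)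
  contDiffAt_proj : ∀ y ∈ M, ContDiffAt ℝ 1 P y
  contDiffAt_normal : ∀ y ∈ M, ContDiffAt ℝ 1 (fun x => n (P x)) y
  continuousOn_proj : ContinuousOn P (Metric.thickening ρ M)
  shape_le : ∀ y ∈ M, ρ * ‖fderiv ℝ (fun x => n (P x)) y‖ ≤ 1 / 2

/-- The signed distance attached to a projection `P` and a normal field `n`. -/
noncomputable def sdist (n P : E3 → E3) (x : E3) : ℝ := inner ℝ (x - P x) (n (P x))

/-- The shape operator, extended by zero to the normal direction. -/
noncomputable def shape (n P : E3 → E3) (y : E3) : E3 →L[ℝ] E3 := fderiv ℝ (fun x => n (P x)) y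

theorem hasDerivAt_line (y : E3) (w : E3) : HasDerivAt (fun r : ℝ => y + r • w) w 0 := by
  simpa using ((hasDerivAt_id (0 : ℝ)).smul_const w).const_add y

namespace IsTube

variable {M : Set E3} {n P : E3 → E3} {ρ : ℝ} (h : IsTube M n P ρ)
include h

theorem nonempty : M.Nonempty := ⟨_, h.proj_mem 0⟩

theorem proj_self {y : E3} (hy : y ∈ M) : P y = y := by
  have := h.dist_proj y
  rw [Metric.infDist_zero_of_mem hy] at this
  exact (dist_eq_zero.mp this).symm

theorem sdist_self {y : E3} (hy : y ∈ M) : sdist n P y = 0 := by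
  rw [sdist, h.proj_self hy, sub_self, inner_zero_left]

theorem sdist_add {y : E3} (hy : y ∈ M) {r : ℝ} (hr : |r| < ρ) : sdist n P (y + r • n y) = r := by
  rw [sdist, h.proj_add y hy r hr, add_sub_cancel_left, real_inner_smul_left,
    real_inner_self_eq_norm_sq, h.norm_normal y hy]
  simp

theorem decomp' {x : E3} (hx : Metric.infDist x M < ρ) : x = P x + sdist n P x • n (P x) :=
  h.decomp x hx

theorem infDist_eq {x : E3} (hx : Metric.infDist x M < ρ) : Metric.infDist x M = |sdist n P x| := by
  rw [← h.dist_proj]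
  have := h.decomp' hx
  rw [dist_eq_norm, sub_eq_iff_eq_add'.mpr this, norm_smul, h.norm_normal _ (h.proj_mem x), mul_one,
    Real.norm_eq_abs]

theorem infDist_add {y : E3} (hy : y ∈ M) {r : ℝ} (hr : |r| < ρ) :
    Metric.infDist (y + r • n y) M = |r| := by
  rw [← h.dist_proj, h.proj_add y hy r hr, dist_eq_norm, add_sub_cancel_left, norm_smul,
    h.norm_normal y hy, mul_one, Real.norm_eq_abs]

theorem eventually_infDist_lt {y : E3} (hy : y ∈ M) : ∀ᶠ x in 𝓝 y, Metric.infDist x M < ρ := by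
  have : Tendsto (fun x => Metric.infDist x M) (𝓝 y) (𝓝 (Metric.infDist y M)) :=
    (Metric.continuous_infDist_pt M).continuousAt
  rw [Metric.infDist_zero_of_mem hy] at this
  exact this.eventually_lt_const h.pos

theorem mem_thickening_iff {x : E3} {ε : ℝ} : x ∈ Metric.thickening ε M ↔ Metric.infDist x M < ε :=
  Metric.mem_thickening_iff_infDist_lt h.nonempty

theorem continuousOn_normal : ContinuousOn n M := by
  intro y hy
  have h1 : ContinuousWithinAt (fun x => n (P x)) M y :=
    (h.contDiffAt_normal y hy).continuousAt.continuousWithinAt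
  refine h1.congr (fun x hx => ?_) ?_
  · rw [h.proj_self hx]
  · rw [h.proj_self hy]

theorem continuousOn_shape : ContinuousOn (shape n P) M := by
  intro y hy
  have h1 := (h.contDiffAt_normal y hy).fderiv_right (m := 0) (by norm_num)
  exact h1.continuousAt.continuousWithinAt

theorem contDiffAt_sdist {y : E3} (hy : y ∈ M) : ContDiffAt ℝ 1 (sdist n P) y :=
  (contDiffAt_id.sub (h.contDiffAt_proj y hy)).inner ℝ (h.contDiffAt_normal y hy)

theorem hasFDerivAt_proj {y : E3} (hy : y ∈ M) : HasFDerivAt P (fderiv ℝ P y) y :=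
  ((h.contDiffAt_proj y hy).differentiableAt one_ne_zero).hasFDerivAt

theorem hasFDerivAt_shape {y : E3} (hy : y ∈ M) : HasFDerivAt (fun x => n (P x)) (shape n P y) y :=
  ((h.contDiffAt_normal y hy).differentiableAt one_ne_zero).hasFDerivAt

theorem hasFDerivAt_sdist {y : E3} (hy : y ∈ M) :
    HasFDerivAt (sdist n P) (fderiv ℝ (sdist n P) y) y :=
  ((h.contDiffAt_sdist hy).differentiableAt one_ne_zero).hasFDerivAt

theorem eventually_abs_lt : ∀ᶠ r : ℝ in 𝓝 0, |r| < ρ := by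
  have : Tendsto (fun r : ℝ => |r|) (𝓝 0) (𝓝 |0|) := continuous_abs.continuousAt
  rw [abs_zero] at this
  exact this.eventually_lt_const h.pos

/-- The derivative equals `1` on `n y`, and its norm is at most `1` because `|sdist|` is the
distance to `M`, hence at most the distance to `y`. A vector of norm at most one with inner product
one against a unit vector is that vector. -/
theorem fderiv_sdist {y : E3} (hy : y ∈ M) : fderiv ℝ (sdist n P) y = innerSL ℝ (n y) := by
  have hd := h.hasFDerivAt_sdist hy
  set d' := fderiv ℝ (sdist n P) y
  have h1 : d' (n y) = 1 := by
    have e1 : HasDerivAt (fun r : ℝ => sdist n P (y + r • n y)) (d' (n y)) 0 := by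
      have := hasDerivAt_line y (n y)
      exact HasFDerivAt.comp_hasDerivAt (0 : ℝ) (by simpa using hd) this
    have e2 : HasDerivAt (fun r : ℝ => sdist n P (y + r • n y)) 1 0 := by
      refine (hasDerivAt_id (0 : ℝ)).congr_of_eventuallyEq ?_
      filter_upwards [h.eventually_abs_lt] with r hr using h.sdist_add hy hr
    exact e1.unique e2
  have h2 : ‖d'‖ ≤ 1 := by
    refine hd.le_of_lip' zero_le_one ?_
    filter_upwards [h.eventually_infDist_lt hy] with x hx
    rw [h.sdist_self hy, sub_zero, Real.norm_eq_abs, ← h.infDist_eq hx, one_mul, ← dist_eq_norm]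
    exact Metric.infDist_le_dist_of_mem hy
  set a := (InnerProductSpace.toDual ℝ E3).symm d'
  have ha : ∀ v, inner ℝ a v = d' v := fun v => InnerProductSpace.toDual_symm_apply
  have ha1 : ‖a‖ ≤ 1 := by rw [LinearIsometryEquiv.norm_map]; exact h2
  have h3 : ‖a - n y‖ ^ 2 ≤ 0 := by
    rw [norm_sub_sq_real, ha, h1, h.norm_normal y hy]
    nlinarith [norm_nonneg a]
  have h4 : a = n y := by
    have : ‖a - n y‖ = 0 := by
      have := norm_nonneg (a - n y)
      nlinarith
    exact sub_eq_zero.mp (norm_eq_zero.mp this)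
  ext v
  rw [← ha, h4, innerSL_apply_apply]

/-- Differentiate `x = P x + sdist x • n (P x)` at a point of `M`; the term with the derivative of
the normal drops out since `sdist` vanishes there. -/
theorem fderiv_proj {y : E3} (hy : y ∈ M) : fderiv ℝ P y = tangentProj (n y) := by
  have h1 : HasFDerivAt (fun x => P x + sdist n P x • n (P x))
      (fderiv ℝ P y + (sdist n P y • shape n P y +
        (fderiv ℝ (sdist n P) y).smulRight (n (P y)))) y :=
    (h.hasFDerivAt_proj hy).add ((h.hasFDerivAt_sdist hy).smul (h.hasFDerivAt_shape hy))
  have h2 : HasFDerivAt (fun x => P x + sdist n P x • n (P x)) (ContinuousLinearMap.id ℝ E3) y := by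
    refine (hasFDerivAt_id y).congr_of_eventuallyEq ?_
    filter_upwards [h.eventually_infDist_lt hy] with x hx using (h.decomp' hx).symm
  have h3 := h1.unique h2
  rw [h.sdist_self hy, h.proj_self hy, h.fderiv_sdist hy] at h3
  ext1 v
  have h4 := congrArg (fun T : E3 →L[ℝ] E3 => T v) h3
  simp only [add_apply, ContinuousLinearMap.smulRight_apply, innerSL_apply_apply,
    ContinuousLinearMap.id_apply, smul_apply, zero_smul, zero_add] at h4
  rw [tangentProj_apply]
  exact eq_sub_of_add_eq h4

theorem shape_normal {y : E3} (hy : y ∈ M) : shape n P y (n y) = 0 := by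
  have e1 : HasDerivAt (fun r : ℝ => n (P (y + r • n y))) (shape n P y (n y)) 0 := by
    have := hasDerivAt_line y (n y)
    exact HasFDerivAt.comp_hasDerivAt (l := fun x => n (P x)) (0 : ℝ)
      (by simpa using h.hasFDerivAt_shape hy) this
  have e2 : HasDerivAt (fun r : ℝ => n (P (y + r • n y))) 0 0 := by
    refine (hasDerivAt_const (0 : ℝ) (n y)).congr_of_eventuallyEq ?_
    filter_upwards [h.eventually_abs_lt] with r hr
    rw [h.proj_add y hy r hr]
  exact e1.unique e2

theorem inner_normal_shape {y : E3} (hy : y ∈ M) (v : E3) : inner ℝ (n y) (shape n P y v) = 0 := by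
  have h1 := (h.hasFDerivAt_shape hy).norm_sq
  have h2 : HasFDerivAt (fun x => ‖n (P x)‖ ^ 2) (0 : E3 →L[ℝ] ℝ) y := by
    have : (fun x => ‖n (P x)‖ ^ 2) = fun _ => 1 := by
      ext x; rw [h.norm_normal _ (h.proj_mem x)]; norm_num
    rw [this]; exact hasFDerivAt_const _ _
  have h3 := congrArg (fun T : E3 →L[ℝ] ℝ => T v) (h1.unique h2)
  simp [h.proj_self hy] at h3
  exact h3

/-- The map flattening the tube near `a`. -/
theorem hasStrictFDerivAt_flatten {a : E3} (ha : a ∈ M) :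
    HasStrictFDerivAt (fun x => tangentProj (n a) (P x) + sdist n P x • n a)
      (ContinuousLinearMap.id ℝ E3) a := by
  have h1 := (h.contDiffAt_proj a ha).hasStrictFDerivAt one_ne_zero
  have h2 := (h.contDiffAt_sdist ha).hasStrictFDerivAt one_ne_zero
  have h3 := ((tangentProj (n a)).hasStrictFDerivAt.comp a h1).add (h2.smul_const (n a))
  refine h3.congr_fderiv ?_
  rw [h.fderiv_proj ha, h.fderiv_sdist ha]
  ext1 v
  simp only [add_apply, ContinuousLinearMap.comp_apply,
    ContinuousLinearMap.smulRight_apply, innerSL_apply_apply, ContinuousLinearMap.id_apply]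
  rw [tangentProj_of_inner_eq_zero (inner_tangentProj (h.norm_normal a ha) v), tangentProj_apply]
  abel

/-- The derivative of the parallel displacement `y ↦ y + r n(y)`. -/
theorem hasStrictFDerivAt_displace {a : E3} (ha : a ∈ M) (r : ℝ) :
    HasStrictFDerivAt (fun x => x + r • n (P x))
      (ContinuousLinearMap.id ℝ E3 + r • shape n P a) a :=
  (hasStrictFDerivAt_id a).add
    (((h.contDiffAt_normal a ha).hasStrictFDerivAt one_ne_zero).const_smul r)

/-- By `shape_le`, a vector `v` in the kernel satisfies `‖v‖ ≤ ‖v‖ / 2`. -/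
theorem injective_displace {a : E3} (ha : a ∈ M) {r : ℝ} (hr : |r| < ρ) :
    Function.Injective (ContinuousLinearMap.id ℝ E3 + r • shape n P a) := by
  rw [injective_iff_map_eq_zero]
  intro v hv
  have h1 : v = -(r • shape n P a v) := by
    rw [eq_neg_iff_add_eq_zero]; simpa using hv
  have h2 : ‖v‖ ≤ 1 / 2 * ‖v‖ := by
    calc ‖v‖ = |r| * ‖shape n P a v‖ := by
          conv_lhs => rw [h1]
          rw [norm_neg, norm_smul, Real.norm_eq_abs]
      _ ≤ ρ * (‖shape n P a‖ * ‖v‖) :=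
          mul_le_mul hr.le (ContinuousLinearMap.le_opNorm _ _) (norm_nonneg _) h.pos.le
      _ = (ρ * ‖shape n P a‖) * ‖v‖ := by ring
      _ ≤ _ := mul_le_mul_of_nonneg_right (h.shape_le a ha) (norm_nonneg _)
  have : ‖v‖ = 0 := by linarith [norm_nonneg v]
  exact norm_eq_zero.mp this

end IsTube

/-! ### The area formula for parallel surfaces -/

theorem ENNReal.le_of_forall_one_lt_pow_mul {a b : ENNReal} (k : ℕ)
    (h : ∀ κ : NNReal, 1 < κ → a ≤ (κ : ENNReal) ^ k * b) : a ≤ b := by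
  have h1 : Tendsto (fun κ : NNReal => (κ : ENNReal) ^ k * b) (𝓝[>] 1) (𝓝 (1 * b)) := by
    refine ENNReal.Tendsto.mul_const ?_ (Or.inl one_ne_zero)
    have : Continuous fun κ : NNReal => ((κ ^ k : NNReal) : ENNReal) :=
      ENNReal.continuous_coe.comp (continuous_pow k)
    have h2 := (this.tendsto 1).mono_left (nhdsWithin_le_nhds (s := Ioi 1))
    simpa using h2
  rw [one_mul] at h1
  exact ge_of_tendsto h1 (eventually_nhdsWithin_of_forall fun κ hκ => h κ hκ)

/-- The Jacobian of the parallel displacement by `r`. -/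
noncomputable def tubeJacobian (n P : E3 → E3) (r : ℝ) (y : E3) : ℝ :=
  (ContinuousLinearMap.id ℝ E3 + r • shape n P y).det

namespace IsTube

variable {M : Set E3} {n P : E3 → E3} {ρ : ℝ} (h : IsTube M n P ρ)
include h

theorem continuousOn_tubeJacobian (r : ℝ) : ContinuousOn (tubeJacobian n P r) M :=
  ContinuousLinearMap.continuous_det.comp_continuousOn
    (continuousOn_const.add (h.continuousOn_shape.const_smul r))

/-- The determinant is `1` at displacement zero and cannot vanish for displacements below `ρ`, by
injectivity, so the intermediate value theorem fixes its sign. -/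
theorem tubeJacobian_pos {y : E3} (hy : y ∈ M) {r : ℝ} (hr : |r| < ρ) :
    0 < tubeJacobian n P r y := by
  by_contra! hneg
  have hc : Continuous fun s : ℝ => tubeJacobian n P s y :=
    ContinuousLinearMap.continuous_det.comp
      (continuous_const.add (continuous_id.smul continuous_const))
  have h0 : tubeJacobian n P 0 y = 1 := by
    have : ContinuousLinearMap.id ℝ E3 + (0 : ℝ) • shape n P y = ContinuousLinearMap.id ℝ E3 := by
      ext1 v; simp
    rw [tubeJacobian, this]
    exact LinearMap.det_id
  have h1 := intermediate_value_uIcc (a := 0) (b := r) (hc.continuousOn)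
  have h2 : (0 : ℝ) ∈ uIcc (tubeJacobian n P 0 y) (tubeJacobian n P r y) := by
    rw [h0, mem_uIcc]; right; exact ⟨hneg, zero_le_one⟩
  obtain ⟨s, hs, hs0⟩ := h1 h2
  have hsr : |s| < ρ := by
    refine lt_of_le_of_lt ?_ hr
    rcases mem_uIcc.mp hs with ⟨h3, h4⟩ | ⟨h3, h4⟩
    · rw [abs_of_nonneg h3, abs_of_nonneg (h3.trans h4)]; exact h4
    · rw [abs_of_nonpos h4, abs_of_nonpos (h3.trans h4)]; linarith
  have h5 := LinearMap.bot_lt_ker_of_det_eq_zero hs0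
  rw [LinearMap.ker_eq_bot.mpr (h.injective_displace hy hsr)] at h5
  exact lt_irrefl _ h5

theorem continuousOn_displace (r : ℝ) : ContinuousOn (fun y => y + r • n y) M :=
  continuousOn_id.add (h.continuousOn_normal.const_smul r)

theorem injOn_displace {r : ℝ} (hr : |r| < ρ) : InjOn (fun y => y + r • n y) M := by
  intro y hy y' hy' e
  rw [← h.proj_add y hy r hr, ← h.proj_add y' hy' r hr]
  exact congrArg P e

/-- Near a point of `M`, areas are comparable with those of the projections to the tangent
plane. -/
theorem exists_nhds_area_tangentProj {a : E3} (ha : a ∈ M) {κ : NNReal} (hκ : 1 < κ) :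
    ∃ U ∈ 𝓝 a, InjOn (tangentProj (n a)) (U ∩ M) ∧ ∀ A ⊆ U ∩ M,
      μHE[2] (tangentProj (n a) '' A) ≤ (κ : ENNReal) ^ 2 * μHE[2] A ∧
      μHE[2] A ≤ (κ : ENNReal) ^ 2 * μHE[2] (tangentProj (n a) '' A) := by
  obtain ⟨U, hU, hb⟩ := (h.hasStrictFDerivAt_flatten ha).exists_nhds_dist_le
    (fun _ _ e => e) hκ
  have hflat : ∀ y ∈ M, tangentProj (n a) (P y) + sdist n P y • n a = tangentProj (n a) y := by
    intro y hy
    rw [h.proj_self hy, h.sdist_self hy, zero_smul, add_zero]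
  have hb' : ∀ y ∈ U ∩ M, ∀ y' ∈ U ∩ M,
      dist (tangentProj (n a) y) (tangentProj (n a) y') ≤ κ * dist (id y) (id y') ∧
      dist (id y) (id y') ≤ κ * dist (tangentProj (n a) y) (tangentProj (n a) y') := by
    intro y hy y' hy'
    have := hb y hy.1 y' hy'.1
    rwa [hflat y hy.2, hflat y' hy'.2] at this
  refine ⟨U, hU, ?_, fun A hA => ⟨?_, ?_⟩⟩
  · intro y hy y' hy' e
    have := (hb' y hy y' hy').2
    rw [e, dist_self, mul_zero] at this
    exact dist_le_zero.mp this
  · have := euclideanHausdorffMeasure_image_le 2 (f := tangentProj (n a)) (g := id) (A := A)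
      (K := κ) (fun y hy y' hy' => (hb' y (hA hy) y' (hA hy')).1)
    rwa [image_id] at this
  · have := euclideanHausdorffMeasure_image_le 2 (f := id) (g := tangentProj (n a)) (A := A)
      (K := κ) (fun y hy y' hy' => (hb' y (hA hy) y' (hA hy')).2)
    rwa [image_id] at this

/-- Three comparisons, each costing `κ ^ 2`: the displacement with its derivative `L`, then `L` with
`L` composed with the flattening map, then `A` with its tangential projection. On `M` the flattening
is the tangential projection, so `L` acts on a planar set and scales its area exactly by its
determinant. -/
theorem exists_nhds_area_displace {a : E3} (ha : a ∈ M) {r : ℝ} (hr : |r| < ρ) {κ : NNReal}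
    (hκ : 1 < κ) :
    ∃ U ∈ 𝓝 a, ∀ A ⊆ U ∩ M, MeasurableSet A →
      μHE[2] ((fun y => y + r • n y) '' A) ≤
        (κ : ENNReal) ^ 6 * (ENNReal.ofReal (tubeJacobian n P r a) * μHE[2] A) ∧
      ENNReal.ofReal (tubeJacobian n P r a) * μHE[2] A ≤
        (κ : ENNReal) ^ 6 * μHE[2] ((fun y => y + r • n y) '' A) := by
  set L : E3 →L[ℝ] E3 := ContinuousLinearMap.id ℝ E3 + r • shape n P a with hLdef
  have hL : Function.Injective L := h.injective_displace ha hr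
  have hLapp : ∀ v, L v = v + r • shape n P a v := fun v => by simp [hLdef]
  obtain ⟨U1, hU1, hb1⟩ := (h.hasStrictFDerivAt_displace ha r).exists_nhds_dist_le hL hκ
  have hLf : HasStrictFDerivAt
      (fun x => L (tangentProj (n a) (P x) + sdist n P x • n a)) L a := by
    have := L.hasStrictFDerivAt.comp a (h.hasStrictFDerivAt_flatten ha)
    exact this
  obtain ⟨U2, hU2, hb2⟩ := hLf.exists_nhds_dist_le hL hκ
  obtain ⟨U3, hU3, hinj, hb3⟩ := h.exists_nhds_area_tangentProj ha hκ
  refine ⟨U1 ∩ (U2 ∩ U3), inter_mem hU1 (inter_mem hU2 hU3), fun A hA hAm => ?_⟩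
  have hA1 : ∀ y ∈ A, y ∈ U1 := fun y hy => (hA hy).1.1
  have hA2 : ∀ y ∈ A, y ∈ U2 := fun y hy => (hA hy).1.2.1
  have hA3 : A ⊆ U3 ∩ M := fun y hy => ⟨(hA hy).1.2.2, (hA hy).2⟩
  have hAM : ∀ y ∈ A, y ∈ M := fun y hy => (hA hy).2
  have e1 : (fun y => y + r • n y) '' A = (fun x => x + r • n (P x)) '' A :=
    image_congr fun y hy => by rw [h.proj_self (hAM y hy)]
  have e2 : (fun x => L (tangentProj (n a) (P x) + sdist n P x • n a)) '' A =
      L '' (tangentProj (n a) '' A) := by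
    rw [image_image]
    refine image_congr fun y hy => ?_
    rw [h.proj_self (hAM y hy), h.sdist_self (hAM y hy), zero_smul, add_zero]
  have e3 : μHE[2] (L '' (tangentProj (n a) '' A)) =
      ENNReal.ofReal (tubeJacobian n P r a) * μHE[2] (tangentProj (n a) '' A) := by
    rw [← abs_of_pos (h.tubeJacobian_pos ha hr)]
    refine euclideanHausdorffMeasure_two_image_linear (h.norm_normal a ha) hL ?_ ?_ ?_ ?_
    · rw [hLapp, h.shape_normal ha, smul_zero, add_zero]
    · intro v
      rw [hLapp, inner_add_right, inner_smul_right, h.inner_normal_shape ha, mul_zero, add_zero]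
    · exact hAm.image_of_continuousOn_injOn (tangentProj (n a)).continuous.continuousOn
        (hinj.mono hA3)
    · rintro _ ⟨x, -, rfl⟩
      exact inner_tangentProj (h.norm_normal a ha) x
  have m1 := euclideanHausdorffMeasure_image_le 2 (f := fun x => x + r • n (P x)) (g := L) (A := A)
    (K := κ) (fun y hy y' hy' => (hb1 y (hA1 y hy) y' (hA1 y' hy')).1)
  have m2 := euclideanHausdorffMeasure_image_le 2 (f := L) (g := fun x => x + r • n (P x)) (A := A)
    (K := κ) (fun y hy y' hy' => (hb1 y (hA1 y hy) y' (hA1 y' hy')).2)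
  have m3 := euclideanHausdorffMeasure_image_le 2 (f := L)
    (g := fun x => L (tangentProj (n a) (P x) + sdist n P x • n a)) (A := A)
    (K := κ) (fun y hy y' hy' => (hb2 y (hA2 y hy) y' (hA2 y' hy')).2)
  have m4 := euclideanHausdorffMeasure_image_le 2
    (f := fun x => L (tangentProj (n a) (P x) + sdist n P x • n a)) (g := L) (A := A)
    (K := κ) (fun y hy y' hy' => (hb2 y (hA2 y hy) y' (hA2 y' hy')).1)
  obtain ⟨m5, m6⟩ := hb3 A hA3
  rw [e2, e3] at m3 m4
  rw [← e1] at m1 m2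
  set J := ENNReal.ofReal (tubeJacobian n P r a)
  constructor
  · calc _ ≤ _ := m1
      _ ≤ (κ : ENNReal) ^ 2 * ((κ : ENNReal) ^ 2 * (J * ((κ : ENNReal) ^ 2 * μHE[2] A))) := by
        gcongr
        exact m3.trans (by gcongr)
      _ = _ := by ring
  · calc _ ≤ J * ((κ : ENNReal) ^ 2 * μHE[2] (tangentProj (n a) '' A)) := by gcongr
      _ = (κ : ENNReal) ^ 2 * (J * μHE[2] (tangentProj (n a) '' A)) := by ring
      _ ≤ (κ : ENNReal) ^ 2 * ((κ : ENNReal) ^ 2 * ((κ : ENNReal) ^ 2 *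
          μHE[2] ((fun y => y + r • n y) '' A))) :=
        mul_le_mul_right (m4.trans (mul_le_mul_right m2 _)) _
      _ = _ := by ring

theorem measurableSet : MeasurableSet M := h.isCompact.measurableSet

theorem measurableSet_displace {r : ℝ} (hr : |r| < ρ) {A : Set E3} (hA : A ⊆ M)
    (hAm : MeasurableSet A) : MeasurableSet ((fun y => y + r • n y) '' A) :=
  hAm.image_of_continuousOn_injOn ((h.continuousOn_displace r).mono hA)
    ((h.injOn_displace hr).mono hA)

/-- Area formula for parallel surfaces. -/
theorem area_displace {r : ℝ} (hr : |r| < ρ) {A : Set E3} (hA : A ⊆ M) (hAm : MeasurableSet A) :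
    μHE[2] ((fun y => y + r • n y) '' A) =
      ∫⁻ y in A, ENNReal.ofReal (tubeJacobian n P r y) ∂μHE[2] := by
  set Φ : E3 → E3 := fun y => y + r • n y with hΦ
  -- By continuity and positivity the Jacobian varies by at most a factor `κ` nearby. This is the
  -- seventh factor in `κ ^ 7`, beside the six of the local comparison.
  have hJnear : ∀ a ∈ M, ∀ κ : NNReal, 1 < κ → ∃ U ∈ 𝓝 a, ∀ y ∈ U ∩ M,
      ENNReal.ofReal (tubeJacobian n P r a) ≤ κ * ENNReal.ofReal (tubeJacobian n P r y) ∧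
      ENNReal.ofReal (tubeJacobian n P r y) ≤ κ * ENNReal.ofReal (tubeJacobian n P r a) := by
    intro a ha κ hκ
    have hpos := h.tubeJacobian_pos ha hr
    have hκ1 : (1 : ℝ) < κ := by exact_mod_cast hκ
    have hcont := h.continuousOn_tubeJacobian r a ha
    have ev1 := hcont.eventually_lt_const (show tubeJacobian n P r a < κ * tubeJacobian n P r a by
      nlinarith)
    have ev2 := hcont.eventually_const_lt (show (κ : ℝ)⁻¹ * tubeJacobian n P r a <
      tubeJacobian n P r a by
        have := inv_lt_one_of_one_lt₀ hκ1
        nlinarith)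
    obtain ⟨U, hU, hUs⟩ := mem_nhdsWithin_iff_exists_mem_nhds_inter.mp (ev1.and ev2)
    refine ⟨U, hU, fun y hy => ?_⟩
    obtain ⟨h1, h2⟩ := hUs hy
    rw [← ENNReal.ofReal_coe_nnreal, ← ENNReal.ofReal_mul (by positivity),
      ← ENNReal.ofReal_mul (by positivity)]
    refine ⟨ENNReal.ofReal_le_ofReal ?_, ENNReal.ofReal_le_ofReal h1.le⟩
    rw [inv_mul_lt_iff₀ (by positivity)] at h2
    exact h2.le
  have key1 : ∀ κ : NNReal, 1 < κ → ∀ A ⊆ M, MeasurableSet A → μHE[2] (Φ '' A) ≤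
      (κ : ENNReal) ^ 7 * ∫⁻ y in A, ENNReal.ofReal (tubeJacobian n P r y) ∂μHE[2] := by
    intro κ hκ
    have := h.isCompact.eventually_le_of_locally_le (l := pure ())
      (m := fun _ A => μHE[2] (Φ '' A)) (k := fun _ A =>
        (κ : ENNReal) ^ 7 * ∫⁻ y in A, ENNReal.ofReal (tubeJacobian n P r y) ∂μHE[2])
      (by simp) (fun _ A B => by rw [image_union]; exact measure_union_le _ _)
      (fun _ A _ B _ _ hB hAB => by rw [lintegral_union hB hAB, mul_add]) ?_
    · exact this
    intro a ha
    obtain ⟨U, hU, h1⟩ := h.exists_nhds_area_displace ha hr hκ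
    obtain ⟨U', hU', h2⟩ := hJnear a ha κ hκ
    refine ⟨U ∩ U', inter_mem hU hU', Eventually.of_forall fun _ A hA hAm => ?_⟩
    have h3 := (h1 A (fun y hy => ⟨(hA hy).1.1, (hA hy).2⟩) hAm).1
    calc _ ≤ _ := h3
      _ ≤ (κ : ENNReal) ^ 6 * (κ * ∫⁻ y in A, ENNReal.ofReal (tubeJacobian n P r y) ∂μHE[2]) := by
        refine mul_le_mul_right ?_ _
        rw [← setLIntegral_const, ← lintegral_const_mul' _ _ (by simp)]
        exact setLIntegral_mono' hAm fun y hy => (h2 y ⟨(hA hy).1.2, (hA hy).2⟩).1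
      _ = _ := by ring
  have key2 : ∀ κ : NNReal, 1 < κ → ∀ A ⊆ M, MeasurableSet A →
      ∫⁻ y in A, ENNReal.ofReal (tubeJacobian n P r y) ∂μHE[2] ≤
      (κ : ENNReal) ^ 7 * μHE[2] (Φ '' A) := by
    intro κ hκ
    have := h.isCompact.eventually_le_of_locally_le (l := pure ())
      (m := fun _ A => ∫⁻ y in A, ENNReal.ofReal (tubeJacobian n P r y) ∂μHE[2])
      (k := fun _ A => (κ : ENNReal) ^ 7 * μHE[2] (Φ '' A))
      (by simp) (fun _ A B => lintegral_union_le _ _ _)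
      (fun _ A hA B hB _ hBm hAB => by
        rw [image_union, measure_union ?_ (h.measurableSet_displace hr hB hBm), mul_add]
        refine disjoint_left.mpr ?_
        rintro _ ⟨x, hx, rfl⟩ ⟨y, hy, e⟩
        exact disjoint_left.mp hAB hx (h.injOn_displace hr (hB hy) (hA hx) e ▸ hy)) ?_
    · exact this
    intro a ha
    obtain ⟨U, hU, h1⟩ := h.exists_nhds_area_displace ha hr hκ
    obtain ⟨U', hU', h2⟩ := hJnear a ha κ hκ
    refine ⟨U ∩ U', inter_mem hU hU', Eventually.of_forall fun _ A hA hAm => ?_⟩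
    have h3 := (h1 A (fun y hy => ⟨(hA hy).1.1, (hA hy).2⟩) hAm).2
    calc _ ≤ ∫⁻ y in A, κ * ENNReal.ofReal (tubeJacobian n P r a) ∂μHE[2] :=
          setLIntegral_mono' hAm fun y hy => (h2 y ⟨(hA hy).1.2, (hA hy).2⟩).2
      _ = κ * (ENNReal.ofReal (tubeJacobian n P r a) * μHE[2] A) := by
          rw [setLIntegral_const, mul_assoc]
      _ ≤ κ * ((κ : ENNReal) ^ 6 * μHE[2] (Φ '' A)) := by gcongr
      _ = _ := by ring
  exact le_antisymm (ENNReal.le_of_forall_one_lt_pow_mul 7 fun κ hκ => key1 κ hκ A hA hAm)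
    (ENNReal.le_of_forall_one_lt_pow_mul 7 fun κ hκ => key2 κ hκ A hA hAm)

/-- Change of variables between `M` and its parallel surfaces. -/
theorem setIntegral_displace {r : ℝ} (hr : |r| < ρ) {f : E3 → ℝ}
    (hf : ContinuousOn f ((fun y => y + r • n y) '' M)) :
    ∫ x in (fun y => y + r • n y) '' M, f x ∂μHE[2] =
      ∫ y in M, tubeJacobian n P r y * f (y + r • n y) ∂μHE[2] := by
  classical
  -- The normal and the Jacobian are controlled only on `M`; extension by zero makes them globally
  -- measurable.
  set N : E3 → E3 := M.piecewise n 0 with hN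
  have hNm : Measurable N :=
    h.continuousOn_normal.measurable_piecewise continuousOn_const h.measurableSet
  set J : E3 → ENNReal := M.piecewise (fun y => ENNReal.ofReal (tubeJacobian n P r y)) 0 with hJ
  have hJm : Measurable J := by
    refine ContinuousOn.measurable_piecewise ?_ continuousOn_const h.measurableSet
    exact ENNReal.continuous_ofReal.comp_continuousOn (h.continuousOn_tubeJacobian r)
  have hNe : ∀ y ∈ M, N y = n y := fun y hy => piecewise_eq_of_mem _ _ _ hy
  have hJe : ∀ y ∈ M, J y = ENNReal.ofReal (tubeJacobian n P r y) :=
    fun y hy => piecewise_eq_of_mem _ _ _ hy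
  have hΨ : Measurable fun y => y + r • N y := measurable_id.add (hNm.const_smul r)
  -- The area formula, applied to preimages, identifies the measure of the parallel surface as the
  -- pushforward of the Jacobian-weighted measure of `M`.
  have hmeas : ((((μHE[2] : Measure E3).restrict M).withDensity J).map fun y => y + r • N y) =
      (μHE[2] : Measure E3).restrict ((fun y => y + r • n y) '' M) := by
    ext B hB
    rw [Measure.map_apply hΨ hB, withDensity_apply _ (hΨ hB),
      Measure.restrict_restrict (hΨ hB), Measure.restrict_apply hB]
    have e1 : B ∩ (fun y => y + r • n y) '' M =
        (fun y => y + r • n y) '' ((fun y => y + r • N y) ⁻¹' B ∩ M) := by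
      ext x
      constructor
      · rintro ⟨hx, y, hy, rfl⟩
        refine ⟨y, ⟨?_, hy⟩, rfl⟩
        rw [mem_preimage, hNe y hy]; exact hx
      · rintro ⟨y, ⟨hy1, hy⟩, rfl⟩
        rw [mem_preimage, hNe y hy] at hy1
        exact ⟨hy1, y, hy, rfl⟩
    rw [e1, h.area_displace hr inter_subset_right ((hΨ hB).inter h.measurableSet)]
    exact setLIntegral_congr_fun ((hΨ hB).inter h.measurableSet) fun y hy => hJe y hy.2
  rw [← hmeas, integral_map hΨ.aemeasurable, integral_withDensity_eq_integral_toReal_smul hJm]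
  · refine setIntegral_congr_fun h.measurableSet fun y hy => ?_
    simp only [smul_eq_mul]
    rw [hJe y hy, hNe y hy, ENNReal.toReal_ofReal (h.tubeJacobian_pos hy hr).le]
  · filter_upwards [ae_restrict_mem h.measurableSet] with y hy
    rw [hJe y hy]; exact ENNReal.ofReal_lt_top
  · rw [hmeas]
    exact hf.aestronglyMeasurable (h.measurableSet_displace hr subset_rfl h.measurableSet)

theorem area_lt_top : μHE[2] M < ⊤ := by
  refine h.isCompact.measure_lt_top_of_nhdsWithin fun a ha => ?_
  obtain ⟨U, hU, -, h1⟩ := h.exists_nhds_area_tangentProj ha (κ := 2) one_lt_two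
  refine ⟨U ∩ M, ?_, ?_⟩
  · exact inter_mem (mem_nhdsWithin_of_mem_nhds hU) self_mem_nhdsWithin
  · refine (h1 _ subset_rfl).2.trans_lt (ENNReal.mul_lt_top (by simp) ?_)
    refine euclideanHausdorffMeasure_two_lt_top (h.norm_normal a ha) ?_ ?_
    · rintro _ ⟨x, -, rfl⟩
      exact inner_tangentProj (h.norm_normal a ha) x
    · exact (h.isCompact.image (tangentProj (n a)).continuous).isBounded.subset
        (image_mono inter_subset_right)

end IsTube

/-! ### Expansion of the Jacobian -/

/-- The trace of an endomorphism of three-dimensional Euclidean space. -/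
noncomputable def traceE3 (W : E3 →L[ℝ] E3) : ℝ := ∑ i, W (EuclideanSpace.single i 1) i

theorem abs_apply_single_le {W : E3 →L[ℝ] E3} {C : ℝ} (hC : ‖W‖ ≤ C) (i j : Fin 3) :
    |W (EuclideanSpace.single j 1) i| ≤ C := by
  have h1 := PiLp.norm_apply_le (W (EuclideanSpace.single j 1)) i
  rw [Real.norm_eq_abs] at h1
  have h2 := W.le_opNorm (EuclideanSpace.single j 1)
  rw [PiLp.norm_single, norm_one, mul_one] at h2
  exact h1.trans (h2.trans hC)

theorem abs_traceE3_le {W : E3 →L[ℝ] E3} {C : ℝ} (hC : ‖W‖ ≤ C) : |traceE3 W| ≤ 3 * C := by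
  refine (Finset.abs_sum_le_sum_abs _ _).trans ?_
  refine (Finset.sum_le_sum fun i _ => abs_apply_single_le hC i i).trans ?_
  simp

/-- Here `e₂` is the sum of the principal two-by-two minors and `e₃` the determinant of `W`; each
has six monomials in entries bounded by `C`. The bounds depend on `C` alone, which makes the later
flux estimate uniform in time. -/
theorem exists_det_id_add_smul {W : E3 →L[ℝ] E3} {C : ℝ} (hC : ‖W‖ ≤ C) :
    ∃ e₂ e₃ : ℝ, |e₂| ≤ 6 * C ^ 2 ∧ |e₃| ≤ 6 * C ^ 3 ∧ ∀ r : ℝ,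
      (ContinuousLinearMap.id ℝ E3 + r • W).det = 1 + r * traceE3 W + r ^ 2 * e₂ + r ^ 3 * e₃ := by
  set w : Fin 3 → Fin 3 → ℝ := fun i j => W (EuclideanSpace.single j 1) i with hw
  have hC0 : 0 ≤ C := (norm_nonneg _).trans hC
  have hb : ∀ i j, |w i j| ≤ C := fun i j => abs_apply_single_le hC i j
  have h2 : ∀ i j k l, |w i j * w k l| ≤ C ^ 2 := fun i j k l => by
    rw [abs_mul, pow_two]; exact mul_le_mul (hb i j) (hb k l) (abs_nonneg _) hC0
  have h3 : ∀ i j k l s t, |w i j * w k l * w s t| ≤ C ^ 3 := fun i j k l s t => by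
    rw [abs_mul, pow_succ]
    exact mul_le_mul (h2 i j k l) (hb s t) (abs_nonneg _) (by positivity)
  refine ⟨w 0 0 * w 1 1 - w 0 1 * w 1 0 + w 0 0 * w 2 2 - w 0 2 * w 2 0 + w 1 1 * w 2 2
    - w 1 2 * w 2 1, w 0 0 * w 1 1 * w 2 2 - w 0 0 * w 1 2 * w 2 1 - w 0 1 * w 1 0 * w 2 2
    + w 0 1 * w 1 2 * w 2 0 + w 0 2 * w 1 0 * w 2 1 - w 0 2 * w 1 1 * w 2 0, ?_, ?_, fun r => ?_⟩
  · have a1 := abs_le.mp (h2 0 0 1 1)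
    have a2 := abs_le.mp (h2 0 1 1 0)
    have a3 := abs_le.mp (h2 0 0 2 2)
    have a4 := abs_le.mp (h2 0 2 2 0)
    have a5 := abs_le.mp (h2 1 1 2 2)
    have a6 := abs_le.mp (h2 1 2 2 1)
    rw [abs_le]; constructor <;> linarith
  · have a1 := abs_le.mp (h3 0 0 1 1 2 2)
    have a2 := abs_le.mp (h3 0 0 1 2 2 1)
    have a3 := abs_le.mp (h3 0 1 1 0 2 2)
    have a4 := abs_le.mp (h3 0 1 1 2 2 0)
    have a5 := abs_le.mp (h3 0 2 1 0 2 1)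
    have a6 := abs_le.mp (h3 0 2 1 1 2 0)
    rw [abs_le]; constructor <;> linarith
  · set b := (EuclideanSpace.basisFun (Fin 3) ℝ).toBasis
    have e1 : (ContinuousLinearMap.id ℝ E3 + r • W).det =
        (LinearMap.toMatrix b b (ContinuousLinearMap.id ℝ E3 + r • W : E3 →L[ℝ] E3)).det :=
      (LinearMap.det_toMatrix b _).symm
    have e2 : ∀ i j, LinearMap.toMatrix b b
        (ContinuousLinearMap.id ℝ E3 + r • W : E3 →L[ℝ] E3) i j =
        (if i = j then 1 else 0) + r * w i j := by
      intro i j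
      rw [LinearMap.toMatrix_apply]
      simp [b, hw]
    rw [e1, Matrix.det_fin_three]
    simp only [e2, traceE3, Fin.sum_univ_three]
    simp only [Fin.isValue, if_true, Fin.reduceEq, if_false]
    ring

namespace IsTube

variable {M : Set E3} {n P : E3 → E3} {ρ : ℝ} (h : IsTube M n P ρ)
include h

/-! ### The boundary of the tube -/

/-- A frontier point has distance exactly `ε`, hence signed distance `± ε`. Conversely, `y ± ε n y`
is approached from inside along its normal segment. -/
theorem frontier_thickening {ε : ℝ} (hε : 0 < ε) (hερ : ε < ρ) :
    frontier (Metric.thickening ε M) =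
      (fun y => y + ε • n y) '' M ∪ (fun y => y + (-ε) • n y) '' M := by
  apply subset_antisymm
  · intro x hx
    have h1 := Metric.frontier_thickening_subset M hx
    have h2 : Metric.infDist x M = ε := by
      rw [Metric.infDist, h1, ENNReal.toReal_ofReal hε.le]
    have h3 : Metric.infDist x M < ρ := h2 ▸ hερ
    have h4 := h.decomp' h3
    rw [h.infDist_eq h3] at h2
    rcases eq_or_eq_neg_of_abs_eq h2 with h5 | h5
    · exact Or.inl ⟨P x, h.proj_mem x, by rw [h5] at h4; exact h4.symm⟩
    · exact Or.inr ⟨P x, h.proj_mem x, by rw [h5] at h4; exact h4.symm⟩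
  · have key : ∀ r : ℝ, |r| = ε → ∀ y ∈ M, y + r • n y ∈ frontier (Metric.thickening ε M) := by
      intro r hr y hy
      rw [Metric.isOpen_thickening.frontier_eq]
      constructor
      · have hlim : Tendsto (fun s : ℝ => y + (s * r) • n y) (𝓝[<] 1) (𝓝 (y + r • n y)) := by
          have hc : Continuous fun s : ℝ => y + (s * r) • n y := by fun_prop
          have := (hc.tendsto 1).mono_left (nhdsWithin_le_nhds (s := Iio 1))
          simpa using this
        refine mem_closure_of_tendsto hlim ?_
        filter_upwards [Ioo_mem_nhdsLT (zero_lt_one' ℝ)] with s hs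
        have hs1 : |s * r| < ε := by
          rw [abs_mul, hr, abs_of_pos hs.1]; nlinarith [hs.2]
        rw [h.mem_thickening_iff, h.infDist_add hy (hs1.trans hερ)]
        exact hs1
      · rw [h.mem_thickening_iff, h.infDist_add hy (hr.trans_lt hερ), hr]
        exact lt_irrefl _
    rintro x (⟨y, hy, rfl⟩ | ⟨y, hy, rfl⟩)
    · exact key ε (abs_of_pos hε) y hy
    · exact key (-ε) (by rw [abs_neg, abs_of_pos hε]) y hy

theorem integrableOn {f : E3 → ℝ} (hf : ContinuousOn f M) : IntegrableOn f M μHE[2] :=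
  hf.integrableOn_of_subset_isCompact h.isCompact h.measurableSet subset_rfl h.area_lt_top.ne

theorem setIntegral_frontier {ε : ℝ} (hε : 0 < ε) (hερ : ε < ρ) {f : E3 → ℝ}
    (hf₁ : ContinuousOn f ((fun y => y + ε • n y) '' M))
    (hf₂ : ContinuousOn f ((fun y => y + (-ε) • n y) '' M)) :
    ∫ x in frontier (Metric.thickening ε M), f x ∂μHE[2] =
      ∫ y in M, (tubeJacobian n P ε y * f (y + ε • n y) +
        tubeJacobian n P (-ε) y * f (y + (-ε) • n y)) ∂μHE[2] := by
  have h1 : |ε| < ρ := by rwa [abs_of_pos hε]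
  have h2 : |-ε| < ρ := by rwa [abs_neg]
  rw [h.frontier_thickening hε hερ]
  have c1 := (h.isCompact.image_of_continuousOn (h.continuousOn_displace ε))
  have c2 := (h.isCompact.image_of_continuousOn (h.continuousOn_displace (-ε)))
  have fin : ∀ r : ℝ, |r| < ρ → μHE[2] ((fun y => y + r • n y) '' M) ≠ ⊤ := by
    intro r hr
    rw [h.area_displace hr subset_rfl h.measurableSet]
    obtain ⟨C, hC⟩ := h.isCompact.exists_bound_of_continuousOn (h.continuousOn_tubeJacobian r)
    refine ne_of_lt ?_
    calc _ ≤ ∫⁻ y in M, ENNReal.ofReal C ∂μHE[2] :=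
          setLIntegral_mono' h.measurableSet fun y hy =>
            ENNReal.ofReal_le_ofReal ((le_abs_self _).trans (hC y hy))
      _ < ⊤ := by
          rw [setLIntegral_const]
          exact ENNReal.mul_lt_top ENNReal.ofReal_lt_top h.area_lt_top
  rw [setIntegral_union ?_ c2.measurableSet ?_ ?_, h.setIntegral_displace h1 hf₁,
    h.setIntegral_displace h2 hf₂, integral_add]
  · exact h.integrableOn ((h.continuousOn_tubeJacobian ε).mul
      (hf₁.comp (h.continuousOn_displace ε) (mapsTo_image _ _)))
  · exact h.integrableOn ((h.continuousOn_tubeJacobian (-ε)).mul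
      (hf₂.comp (h.continuousOn_displace (-ε)) (mapsTo_image _ _)))
  · refine disjoint_left.mpr ?_
    rintro _ ⟨x, hx, rfl⟩ ⟨y, hy, e⟩
    have e1 := congrArg (sdist n P) e
    simp only at e1
    rw [h.sdist_add hx h1, h.sdist_add hy h2] at e1
    linarith
  · exact hf₁.integrableOn_of_subset_isCompact c1 c1.measurableSet subset_rfl (fin ε h1)
  · exact hf₂.integrableOn_of_subset_isCompact c2 c2.measurableSet subset_rfl (fin (-ε) h2)

/-! ### Volumes in the thin tube -/

/-- The flattening map sends the part of the tube over `A` exactly onto the prism of height `2 * ε`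
over the tangential projection of `A`. Its bi-Lipschitz constant costs `κ ^ 3` in volume, and the
projection costs `κ ^ 2` in area. -/
theorem exists_nhds_volume {a : E3} (ha : a ∈ M) {κ : NNReal} (hκ : 1 < κ) :
    ∃ U ∈ 𝓝 a, ∀ᶠ ε in 𝓝[>] (0 : ℝ), ∀ A ⊆ U ∩ M, MeasurableSet A →
      volume (P ⁻¹' A ∩ Metric.thickening ε M) ≤
        (κ : ENNReal) ^ 5 * (ENNReal.ofReal (2 * ε) * μHE[2] A) ∧
      ENNReal.ofReal (2 * ε) * μHE[2] A ≤
        (κ : ENNReal) ^ 5 * volume (P ⁻¹' A ∩ Metric.thickening ε M) := by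
  obtain ⟨U0, hU0, hb⟩ := (h.hasStrictFDerivAt_flatten ha).exists_nhds_dist_le
    (fun _ _ e => e) hκ
  obtain ⟨U1, hU1, hinj, h1⟩ := h.exists_nhds_area_tangentProj ha hκ
  obtain ⟨s, hs, hball⟩ := Metric.mem_nhds_iff.mp hU0
  -- Base points within `s / 2` of `a` and fibres shorter than `s / 2` keep the whole piece of tube
  -- in the ball of radius `s`, where the flattening is controlled.
  refine ⟨Metric.ball a (s / 2) ∩ U1, inter_mem (Metric.ball_mem_nhds _ (by positivity)) hU1, ?_⟩
  filter_upwards [Ioo_mem_nhdsGT (show 0 < min (s / 2) ρ by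
    have := h.pos; positivity)] with ε hε A hA hAm
  obtain ⟨hε0, hε1⟩ := hε
  have hεs := hε1.trans_le (min_le_left _ _)
  have hερ := hε1.trans_le (min_le_right _ _)
  have hA1 : A ⊆ U1 ∩ M := fun y hy => ⟨(hA hy).1.2, (hA hy).2⟩
  set S := P ⁻¹' A ∩ Metric.thickening ε M with hS
  have hSd : ∀ x ∈ S, Metric.infDist x M < ε := fun x hx => h.mem_thickening_iff.mp hx.2
  have hSU : S ⊆ U0 := by
    intro x hx
    apply hball
    have d1 : dist x (P x) < s / 2 := by rw [h.dist_proj]; exact (hSd x hx).trans hεs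
    have d2 : dist (P x) a < s / 2 := (hA hx.1).1.1
    rw [Metric.mem_ball]
    linarith [dist_triangle x (P x) a]
  set F : E3 → E3 := fun x => tangentProj (n a) (P x) + sdist n P x • n a with hF
  have hna := h.norm_normal a ha
  have htp : ∀ y : E3, ∀ r : ℝ, tangentProj (n a) (tangentProj (n a) y + r • n a) =
      tangentProj (n a) y ∧ inner ℝ (n a) (tangentProj (n a) y + r • n a) = r := by
    intro y r
    have e : inner ℝ (n a) (tangentProj (n a) y + r • n a) = r := by
      rw [inner_add_right, inner_tangentProj hna, inner_smul_right, real_inner_self_eq_norm_sq, hna]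
      simp
    refine ⟨?_, e⟩
    rw [tangentProj_apply (n a) (_ + _), e, add_sub_cancel_right]
  have himg : F '' S = prism (n a) (tangentProj (n a) '' A) (-ε) ε := by
    ext z
    constructor
    · rintro ⟨x, hx, rfl⟩
      refine ⟨?_, ?_⟩
      · rw [hF, (htp _ _).1]; exact ⟨P x, hx.1, rfl⟩
      · rw [hF, (htp _ _).2, mem_Ioo, ← abs_lt, ← h.infDist_eq ((hSd x hx).trans hερ)]
        exact hSd x hx
    · rintro ⟨⟨y, hy, e⟩, hz⟩
      have hr : |inner ℝ (n a) z| < ε := abs_lt.mpr hz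
      have hyM := (hA hy).2
      have hpr := h.proj_add y hyM _ (hr.trans hερ)
      refine ⟨y + (inner ℝ (n a) z : ℝ) • n y, ⟨?_, ?_⟩, ?_⟩
      · rw [mem_preimage, hpr]; exact hy
      · rw [h.mem_thickening_iff, h.infDist_add hyM (hr.trans hερ)]; exact hr
      · simp only [hF]
        rw [hpr, h.sdist_add hyM (hr.trans hερ), e, tangentProj_apply, sub_add_cancel]
  have hvol : volume (F '' S) = ENNReal.ofReal (2 * ε) * μHE[2] (tangentProj (n a) '' A) := by
    rw [himg, volume_prism hna ?_ ?_]
    · congr 2; ring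
    · exact hAm.image_of_continuousOn_injOn (tangentProj (n a)).continuous.continuousOn
        (hinj.mono hA1)
    · rintro _ ⟨x, -, rfl⟩
      exact inner_tangentProj hna x
  have m1 := euclideanHausdorffMeasure_image_le 3 (f := F) (g := id) (A := S) (K := κ)
    (fun y hy y' hy' => (hb y (hSU hy) y' (hSU hy')).1)
  have m2 := euclideanHausdorffMeasure_image_le 3 (f := id) (g := F) (A := S) (K := κ)
    (fun y hy y' hy' => (hb y (hSU hy) y' (hSU hy')).2)
  rw [image_id, euclideanHausdorffMeasure_three, hvol] at m1 m2
  obtain ⟨m3, m4⟩ := h1 A hA1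
  constructor
  · calc _ ≤ _ := m2
      _ ≤ (κ : ENNReal) ^ 3 * (ENNReal.ofReal (2 * ε) * ((κ : ENNReal) ^ 2 * μHE[2] A)) := by
        gcongr
      _ = _ := by ring
  · calc _ ≤ ENNReal.ofReal (2 * ε) * ((κ : ENNReal) ^ 2 * μHE[2] (tangentProj (n a) '' A)) := by
          gcongr
      _ = (κ : ENNReal) ^ 2 * (ENNReal.ofReal (2 * ε) * μHE[2] (tangentProj (n a) '' A)) := by ring
      _ ≤ (κ : ENNReal) ^ 2 * ((κ : ENNReal) ^ 3 * volume S) := by gcongr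
      _ = _ := by ring

theorem aemeasurable_proj {ε : ℝ} (hε : ε ≤ ρ) :
    AEMeasurable P (volume.restrict (Metric.thickening ε M)) :=
  (h.continuousOn_proj.mono (Metric.thickening_mono hε M)).aemeasurable
    Metric.isOpen_thickening.measurableSet

/-- The pushforward of the volume of the thin tube is comparable with the area. -/
theorem eventually_map_proj {κ : NNReal} (hκ : 1 < κ) :
    ∀ᶠ ε in 𝓝[>] (0 : ℝ),
      (volume.restrict (Metric.thickening ε M)).map P ≤
        ((κ : ENNReal) ^ 5 * ENNReal.ofReal (2 * ε)) • (μHE[2] : Measure E3).restrict M ∧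
      ENNReal.ofReal (2 * ε) • (μHE[2] : Measure E3).restrict M ≤
        (κ : ENNReal) ^ 5 • (volume.restrict (Metric.thickening ε M)).map P := by
  have hP : ∀ ε ≤ ρ, ∀ B, MeasurableSet B → (volume.restrict (Metric.thickening ε M)).map P B =
      volume (P ⁻¹' (B ∩ M) ∩ Metric.thickening ε M) := by
    intro ε hε B hB
    rw [Measure.map_apply_of_aemeasurable (h.aemeasurable_proj hε) hB,
      Measure.restrict_apply' Metric.isOpen_thickening.measurableSet]
    congr 2
    ext x
    simp [h.proj_mem x]
  have hsub : ∀ ε : ℝ, ∀ A B : Set E3, volume (P ⁻¹' (A ∪ B) ∩ Metric.thickening ε M) ≤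
      volume (P ⁻¹' A ∩ Metric.thickening ε M) + volume (P ⁻¹' B ∩ Metric.thickening ε M) := by
    intro ε A B
    rw [preimage_union, union_inter_distrib_right]
    exact measure_union_le _ _
  have k1 : ∀ᶠ ε in 𝓝[>] (0 : ℝ), ∀ A ⊆ M, MeasurableSet A →
      volume (P ⁻¹' A ∩ Metric.thickening ε M) ≤
        (κ : ENNReal) ^ 5 * (ENNReal.ofReal (2 * ε) * μHE[2] A) := by
    refine h.isCompact.eventually_le_of_locally_le
      (m := fun ε A => volume (P ⁻¹' A ∩ Metric.thickening ε M)) (by simp) hsub ?_ ?_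
    · intro ε A _ B _ _ hB hAB
      rw [measure_union hAB hB]
      exact le_of_eq (by ring)
    · intro a ha
      obtain ⟨U, hU, h1⟩ := h.exists_nhds_volume ha hκ
      exact ⟨U, hU, h1.mono fun ε h2 A hA hAm => (h2 A hA hAm).1⟩
  -- Superadditivity of the right side is required for every index, but measurability of `P` is
  -- available only up to radius `ρ`; hence the truncation `min ε ρ`, which is harmless for small
  -- `ε`.
  have k3 : ∀ᶠ ε in 𝓝[>] (0 : ℝ), ∀ A ⊆ M, MeasurableSet A →
      ENNReal.ofReal (2 * min ε ρ) * μHE[2] A ≤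
        (κ : ENNReal) ^ 5 * volume (P ⁻¹' A ∩ Metric.thickening (min ε ρ) M) := by
    refine h.isCompact.eventually_le_of_locally_le
      (m := fun ε A => ENNReal.ofReal (2 * min ε ρ) * μHE[2] A) (by simp) ?_ ?_ ?_
    · intro ε A B
      rw [← mul_add]
      exact mul_le_mul_right (measure_union_le _ _) _
    · intro ε A hA B hB hAm hBm hAB
      have e : ∀ C ⊆ M, MeasurableSet C → volume (P ⁻¹' C ∩ Metric.thickening (min ε ρ) M) =
          (volume.restrict (Metric.thickening (min ε ρ) M)).map P C := fun C hC hCm => by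
        rw [hP _ (min_le_right _ _) C hCm, inter_eq_left.mpr hC]
      rw [e _ hA hAm, e _ hB hBm, e _ (union_subset hA hB) (hAm.union hBm),
        measure_union hAB hBm, mul_add]
    · intro a ha
      obtain ⟨U, hU, h1⟩ := h.exists_nhds_volume ha hκ
      refine ⟨U, hU, ?_⟩
      filter_upwards [h1, Ioo_mem_nhdsGT h.pos] with ε h2 hε A hA hAm
      rw [min_eq_left hε.2.le]
      exact (h2 A hA hAm).2
  filter_upwards [k1, k3, Ioo_mem_nhdsGT h.pos] with ε h1 h2 hε
  rw [min_eq_left hε.2.le] at h2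
  constructor
  · refine Measure.le_iff.mpr fun B hB => ?_
    rw [hP ε hε.2.le B hB, Measure.smul_apply, Measure.restrict_apply hB, smul_eq_mul, mul_assoc]
    exact h1 _ inter_subset_right (hB.inter h.measurableSet)
  · refine Measure.le_iff.mpr fun B hB => ?_
    rw [Measure.smul_apply, Measure.smul_apply, hP ε hε.2.le B hB, Measure.restrict_apply hB,
      smul_eq_mul, smul_eq_mul]
    exact h2 _ inter_subset_right (hB.inter h.measurableSet)

end IsTube

/-! ### Limits of integrals over the thin tube -/

namespace IsTube

variable {M : Set E3} {n P : E3 → E3} {ρ : ℝ} (h : IsTube M n P ρ)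
include h

/-- Comparison of integrals over the thin tube with integrals over the surface. -/
theorem eventually_setIntegral_proj {g : E3 → ℝ} (hg : ContinuousOn g M) (hg0 : ∀ y ∈ M, 0 ≤ g y)
    {κ : NNReal} (hκ : 1 < κ) :
    ∀ᶠ ε in 𝓝[>] (0 : ℝ), IntegrableOn (fun x => g (P x)) (Metric.thickening ε M) ∧
      ∫ x in Metric.thickening ε M, g (P x) ≤ κ ^ 5 * (2 * ε) * ∫ y in M, g y ∂μHE[2] ∧
      2 * ε * ∫ y in M, g y ∂μHE[2] ≤ κ ^ 5 * ∫ x in Metric.thickening ε M, g (P x) := by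
  filter_upwards [h.eventually_map_proj hκ, Ioo_mem_nhdsGT h.pos] with ε ⟨h1, h2⟩ hε
  have hint := h.integrableOn hg
  have hP := h.aemeasurable_proj hε.2.le
  have hintm : Integrable g ((volume.restrict (Metric.thickening ε M)).map P) :=
    (hint.smul_measure (ENNReal.mul_ne_top (by simp) ENNReal.ofReal_ne_top)).mono_measure h1
  have e1 : ∫ x in Metric.thickening ε M, g (P x) =
      ∫ y, g y ∂((volume.restrict (Metric.thickening ε M)).map P) :=
    (integral_map hP hintm.aestronglyMeasurable).symm
  have hpos1 : 0 ≤ᵐ[(μHE[2] : Measure E3).restrict M] g := by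
    filter_upwards [ae_restrict_mem h.measurableSet] with y hy using hg0 y hy
  have hmem : ∀ᵐ y ∂((volume.restrict (Metric.thickening ε M)).map P), y ∈ M := by
    have hm : MeasurableSet {y | y ∈ M} := h.measurableSet
    rw [ae_map_iff hP hm]
    exact Eventually.of_forall h.proj_mem
  have hpos2 : 0 ≤ᵐ[(volume.restrict (Metric.thickening ε M)).map P] g := by
    filter_upwards [hmem] with y hy using hg0 y hy
  refine ⟨hintm.comp_aemeasurable hP, ?_, ?_⟩
  · rw [e1]
    have := integral_mono_measure h1 (Measure.ae_smul_measure hpos1 _)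
      (hint.smul_measure (ENNReal.mul_ne_top (by simp) ENNReal.ofReal_ne_top))
    rw [integral_smul_measure] at this
    simpa [ENNReal.toReal_mul, ENNReal.toReal_ofReal, hε.1.le] using this
  · rw [e1]
    have := integral_mono_measure h2 (Measure.ae_smul_measure hpos2 _)
      (hintm.smul_measure (by simp))
    rw [integral_smul_measure, integral_smul_measure] at this
    simpa [ENNReal.toReal_mul, ENNReal.toReal_ofReal, hε.1.le] using this

/-- For each `κ > 1` the rescaled integral eventually lies between `κ⁻⁵` and `κ⁵` times the limit;
choose `κ` close enough to `1`. -/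
theorem tendsto_setIntegral_proj {g : E3 → ℝ} (hg : ContinuousOn g M) (hg0 : ∀ y ∈ M, 0 ≤ g y) :
    Tendsto (fun ε : ℝ => (2 * ε)⁻¹ * ∫ x in Metric.thickening ε M, g (P x)) (𝓝[>] 0)
      (𝓝 (∫ y in M, g y ∂μHE[2])) := by
  set G := ∫ y in M, g y ∂μHE[2]
  have hlim : Tendsto (fun κ : NNReal => (κ : ℝ) ^ 5 * G) (𝓝[>] 1) (𝓝 G) := by
    have hc : Continuous fun κ : NNReal => (κ : ℝ) ^ 5 * G := by fun_prop
    have := (hc.tendsto 1).mono_left (nhdsWithin_le_nhds (s := Ioi 1))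
    simpa using this
  have hlim' : Tendsto (fun κ : NNReal => ((κ : ℝ) ^ 5)⁻¹ * G) (𝓝[>] 1) (𝓝 G) := by
    have hc : ContinuousAt (fun κ : NNReal => ((κ : ℝ) ^ 5)⁻¹ * G) 1 := by
      refine ContinuousAt.mul (ContinuousAt.inv₀ (by fun_prop) (by simp)) continuousAt_const
    have := hc.tendsto.mono_left (nhdsWithin_le_nhds (s := Ioi 1))
    simpa using this
  refine tendsto_order.mpr ⟨fun c hc => ?_, fun c hc => ?_⟩
  · obtain ⟨κ, h1, h2⟩ := ((hlim'.eventually_const_lt hc).and self_mem_nhdsWithin).exists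
    filter_upwards [h.eventually_setIntegral_proj hg hg0 h2, self_mem_nhdsWithin] with ε hb hε
    have hε0 : (0 : ℝ) < 2 * ε := by have : 0 < ε := hε; positivity
    have hκ0 : (0 : ℝ) < (κ : ℝ) ^ 5 := by
      have : (1 : NNReal) < κ := h2
      have : (1 : ℝ) < κ := by exact_mod_cast this
      positivity
    refine h1.trans_le ?_
    rw [inv_mul_le_iff₀ hκ0, ← mul_assoc, mul_comm _ (2 * ε)⁻¹, mul_assoc, le_inv_mul_iff₀ hε0]
    exact hb.2.2
  · obtain ⟨κ, h1, h2⟩ := ((hlim.eventually_lt_const hc).and self_mem_nhdsWithin).exists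
    filter_upwards [h.eventually_setIntegral_proj hg hg0 h2, self_mem_nhdsWithin] with ε hb hε
    have hε0 : (0 : ℝ) < 2 * ε := by have : 0 < ε := hε; positivity
    refine lt_of_le_of_lt ?_ h1
    rw [inv_mul_le_iff₀ hε0]
    exact hb.2.1.trans_eq (by ring)

/-- Replacing `f ε` by `g ∘ P` costs at most `C * ε` times the rescaled volume of the tube, and that
volume converges to the area. -/
theorem tendsto_setIntegral_thickening {g : E3 → ℝ} (hg : ContinuousOn g M)
    (hg0 : ∀ y ∈ M, 0 ≤ g y) {f : ℝ → E3 → ℝ}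
    (hf : ∀ᶠ ε in 𝓝[>] (0 : ℝ), ContinuousOn (f ε) (Metric.thickening ε M)) {C : ℝ}
    (hfg : ∀ᶠ ε in 𝓝[>] (0 : ℝ), ∀ x ∈ Metric.thickening ε M, |f ε x - g (P x)| ≤ C * ε) :
    Tendsto (fun ε : ℝ => (2 * ε)⁻¹ * ∫ x in Metric.thickening ε M, f ε x) (𝓝[>] 0)
      (𝓝 (∫ y in M, g y ∂μHE[2])) := by
  have h1 := h.tendsto_setIntegral_proj hg hg0
  have h2 := h.tendsto_setIntegral_proj (g := fun _ => 1) continuousOn_const (by simp)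
  set A := ∫ y in M, (1 : ℝ) ∂μHE[2]
  have hid : Tendsto (fun ε : ℝ => C * ε) (𝓝[>] 0) (𝓝 0) := by
    have hc : Continuous fun ε : ℝ => C * ε := by fun_prop
    have := (hc.tendsto 0).mono_left (nhdsWithin_le_nhds (s := Ioi 0))
    simpa using this
  have h3 := hid.mul h2
  rw [zero_mul] at h3
  rw [tendsto_iff_dist_tendsto_zero] at h1 ⊢
  have h4 := h3.add h1
  rw [add_zero] at h4
  refine squeeze_zero' (Eventually.of_forall fun _ => dist_nonneg) ?_ h4
  filter_upwards [hf, hfg, self_mem_nhdsWithin,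
    h.eventually_setIntegral_proj hg hg0 (κ := 2) one_lt_two,
    h.eventually_setIntegral_proj (g := fun _ => 1) continuousOn_const (by simp) (κ := 2)
      one_lt_two] with ε hc hb hε hi hi1
  have hε0 : (0 : ℝ) < 2 * ε := by have : 0 < ε := hε; positivity
  refine (dist_triangle _ ((2 * ε)⁻¹ * ∫ x in Metric.thickening ε M, g (P x)) _).trans ?_
  refine add_le_add ?_ le_rfl
  have hO : MeasurableSet (Metric.thickening ε M) := Metric.isOpen_thickening.measurableSet
  have hsub : IntegrableOn (fun x => f ε x - g (P x)) (Metric.thickening ε M) := by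
    refine Integrable.mono' (hi1.1.const_mul (C * ε)) ?_ ?_
    · exact (hc.aestronglyMeasurable hO).sub hi.1.aestronglyMeasurable
    · filter_upwards [ae_restrict_mem hO] with x hx
      rw [mul_one]
      exact hb x hx
  have hfi : IntegrableOn (f ε) (Metric.thickening ε M) := by
    have := hsub.add hi.1
    refine this.congr (Eventually.of_forall fun x => ?_)
    simp
  rw [Real.dist_eq, ← mul_sub, ← integral_sub hfi hi.1, abs_mul, abs_of_pos (inv_pos.mpr hε0),
    mul_left_comm]
  refine mul_le_mul_of_nonneg_left ?_ (inv_pos.mpr hε0).le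
  rw [← integral_const_mul]
  refine (abs_integral_le_integral_abs).trans ?_
  refine setIntegral_mono_on hsub.abs (hi1.1.const_mul (C * ε)) hO fun x hx => ?_
  rw [mul_one]
  exact hb x hx

end IsTube

/-! ### Local structure of the moving surface -/

theorem ContDiffAt.exists_local_inverse {E : Type*} [NormedAddCommGroup E] [NormedSpace ℝ E]
    [FiniteDimensional ℝ E] {f : E → E} {f' : E →L[ℝ] E} {a : E} (hf : ContDiffAt ℝ ∞ f a)
    (hf' : HasFDerivAt f f' a) (hinj : Function.Injective f') :
    ∃ g : E → E, ContDiffAt ℝ ∞ g (f a) ∧ g (f a) = a ∧ (∀ᶠ x in 𝓝 a, g (f x) = x) ∧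
      ∀ᶠ y in 𝓝 (f a), f (g y) = y := by
  have : CompleteSpace E := FiniteDimensional.complete ℝ E
  let e : E ≃L[ℝ] E := (LinearEquiv.ofInjectiveEndo f'.toLinearMap hinj).toContinuousLinearEquiv
  have he : (e : E →L[ℝ] E) = f' := by
    ext x
    rfl
  have hfe : HasFDerivAt f (e : E →L[ℝ] E) a := by rw [he]; exact hf'
  have hs : HasStrictFDerivAt f (e : E →L[ℝ] E) a := hf.hasStrictFDerivAt' hfe (by simp)
  exact ⟨hs.localInverse f e a, hf.to_localInverse hfe (by simp), hs.localInverse_apply_image,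
    hs.eventually_left_inverse, hs.eventually_right_inverse⟩

/-- Lagrange multipliers: the vector from a closest point is normal to a level set. -/
theorem exists_sub_eq_smul_of_isMin {f : E3 → ℝ} {f' : E3 →L[ℝ] ℝ} {S : Set E3} {x y g : E3}
    (hf : HasStrictFDerivAt f f' y) (hg : ∀ v, f' v = inner ℝ g v) (hg0 : g ≠ 0) (hy : f y = 0)
    (hS : ∀ᶠ y' in 𝓝 y, f y' = 0 → y' ∈ S) (hmin : ∀ y' ∈ S, dist x y ≤ dist x y') :
    ∃ c : ℝ, x - y = c • g := by
  have hextr : IsLocalExtrOn (fun y' => ‖x - y'‖ ^ 2) {y' | f y' = f y} y := by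
    refine Or.inl ?_
    have : ∀ᶠ y' in 𝓝[{y' | f y' = f y}] y, ‖x - y‖ ^ 2 ≤ ‖x - y'‖ ^ 2 := by
      filter_upwards [mem_nhdsWithin_of_mem_nhds hS, self_mem_nhdsWithin] with y' h1 h2
      have h3 := hmin y' (h1 (by rw [← hy]; exact h2))
      rw [dist_eq_norm, dist_eq_norm] at h3
      gcongr
    exact this
  have hψ : HasStrictFDerivAt (fun y' : E3 => ‖x - y'‖ ^ 2)
      (2 • (innerSL ℝ (x - y)).comp (-ContinuousLinearMap.id ℝ E3)) y :=
    (hasStrictFDerivAt_norm_sq (x - y)).comp y ((hasStrictFDerivAt_id y).const_sub x)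
  obtain ⟨a, b, hab, hsum⟩ := hextr.exists_multipliers_of_hasStrictFDerivAt_1d hf hψ
  have key : ∀ v, inner ℝ (a • g - (2 * b) • (x - y)) v = 0 := by
    intro v
    have := congrArg (fun T : E3 →L[ℝ] ℝ => T v) hsum
    simp [hg] at this
    rw [inner_sub_left, real_inner_smul_left, real_inner_smul_left, inner_sub_left]
    linarith
  have key2 : a • g = (2 * b) • (x - y) := by
    have := key (a • g - (2 * b) • (x - y))
    exact sub_eq_zero.mp (inner_self_eq_zero.mp this)
  have hb : b ≠ 0 := by
    rintro rfl
    rw [mul_zero, zero_smul, smul_eq_zero] at key2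
    rcases key2 with h | h
    · exact hab (by rw [h]; rfl)
    · exact hg0 h
  refine ⟨(2 * b)⁻¹ * a, ?_⟩
  rw [mul_smul, key2, smul_smul, inv_mul_cancel₀ (by positivity), one_smul]

namespace OrientedMovingSurface

variable {T : ℝ} (Γ : OrientedMovingSurface T)

theorem isCompact_slab {a b : ℝ} (ha : 0 ≤ a) (hb : b ≤ T) :
    IsCompact {z : ℝ × E3 | z.1 ∈ Icc a b ∧ z.2 ∈ Γ.carrier z.1} := by
  have h1 := Γ.isCompact_spaceTime.inter_right
    (isClosed_Icc (a := a) (b := b) |>.preimage continuous_fst)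
  convert h1 using 1
  ext z
  exact ⟨fun h => ⟨⟨⟨ha.trans h.1.1, h.1.2.trans hb⟩, h.2⟩, h.1⟩, fun h => ⟨h.2, h.1.2⟩⟩

theorem isCompact_carrier {t : ℝ} (ht : t ∈ Icc 0 T) : IsCompact (Γ.carrier t) := by
  have h1 := (Γ.isCompact_slab ht.1 ht.2).image continuous_snd
  convert h1 using 1
  ext y
  constructor
  · exact fun hy => ⟨(t, y), ⟨⟨le_rfl, le_rfl⟩, hy⟩, rfl⟩
  · rintro ⟨⟨s, x⟩, ⟨hs, hx⟩, rfl⟩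
    have : s = t := le_antisymm hs.2 hs.1
    exact this ▸ hx

theorem nonempty_carrier {t : ℝ} (ht : t ∈ Icc 0 T) : (Γ.carrier t).Nonempty :=
  (Γ.isConnected t ht).nonempty

theorem closestPoint_spec {t : ℝ} (ht : t ∈ Icc 0 T) (x : E3) :
    Γ.closestPoint t x ∈ Γ.carrier t ∧
      dist x (Γ.closestPoint t x) = Metric.infDist x (Γ.carrier t) := by
  obtain ⟨y, hy, hd⟩ := (Γ.isCompact_carrier ht).exists_infDist_eq_dist (Γ.nonempty_carrier ht) x
  exact Classical.epsilon_spec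
    (p := fun y => y ∈ Γ.carrier t ∧ dist x y = Metric.infDist x (Γ.carrier t)) ⟨y, hy, hd.symm⟩

theorem dist_closestPoint_le {t : ℝ} (ht : t ∈ Icc 0 T) (x : E3) {y : E3} (hy : y ∈ Γ.carrier t) :
    dist x (Γ.closestPoint t x) ≤ dist x y := by
  rw [(Γ.closestPoint_spec ht x).2]
  exact Metric.infDist_le_dist_of_mem hy

/-- A defining function with its spatial gradient in joint form. -/
theorem exists_defining_gradient {t₀ : ℝ} (ht₀ : t₀ ∈ Ioo 0 T) {y₀ : E3} (hy₀ : y₀ ∈ Γ.carrier t₀) :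
    ∃ (φ : ℝ × E3 → ℝ) (g : ℝ × E3 → E3), ContDiff ℝ ∞ φ ∧ ContDiff ℝ ∞ g ∧
      (∀ z v, fderiv ℝ φ z (0, v) = inner ℝ (g z) v) ∧
      ∀ᶠ z in 𝓝 (t₀, y₀), z.1 ∈ Ioo 0 T ∧ (z.2 ∈ Γ.carrier z.1 ↔ φ z = 0) ∧ g z ≠ 0 ∧
        (z.2 ∈ Γ.carrier z.1 → Γ.normal z.1 z.2 = ‖g z‖⁻¹ • g z) := by
  obtain ⟨φ, hφ, hev⟩ := Γ.exists_defining_function t₀ (Ioo_subset_Icc_self ht₀) y₀ hy₀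
  set g : ℝ × E3 → E3 := fun z => (InnerProductSpace.toDual ℝ E3).symm
    ((fderiv ℝ φ z).comp (ContinuousLinearMap.inr ℝ ℝ E3)) with hg
  have hgrad : ∀ z : ℝ × E3, gradient (fun x => φ (z.1, x)) z.2 = g z := by
    intro z
    have h1 : HasFDerivAt φ (fderiv ℝ φ z) (z.1, z.2) :=
      (hφ.differentiable (by simp) z).hasFDerivAt
    have h2 := h1.comp z.2 (hasFDerivAt_prodMk_right z.1 z.2)
    rw [gradient, hg]
    congr 1
    exact h2.fderiv
  refine ⟨φ, g, hφ, ?_, ?_, ?_⟩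
  · have h1 : ContDiff ℝ ∞ (fderiv ℝ φ) := hφ.fderiv_right (by simp)
    have h2 : ContDiff ℝ ∞ fun z => (fderiv ℝ φ z).comp (ContinuousLinearMap.inr ℝ ℝ E3) :=
      h1.clm_comp contDiff_const
    exact (InnerProductSpace.toDual ℝ E3).symm.contDiff.comp h2
  · intro z v
    rw [hg, InnerProductSpace.toDual_symm_apply]
    simp
  · have hT : ∀ᶠ z : ℝ × E3 in 𝓝 (t₀, y₀), z.1 ∈ Ioo 0 T :=
      continuous_fst.continuousAt.eventually_mem (Ioo_mem_nhds ht₀.1 ht₀.2)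
    filter_upwards [hev, hT] with z hz hzT
    obtain ⟨h1, h2, h3⟩ := hz (Ioo_subset_Icc_self hzT)
    rw [hgrad] at h2 h3
    exact ⟨hzT, h1, h2, h3⟩

/-- The tubular coordinates `(t, y, r) ↦ (t, y + r n(t, y))`, with the defining function as the
remaining coordinate, form a local diffeomorphism. -/
theorem exists_tubular_inverse {φ : ℝ × E3 → ℝ} {g : ℝ × E3 → E3} (hφ : ContDiff ℝ ∞ φ)
    (hg : ContDiff ℝ ∞ g) (hφg : ∀ z v, fderiv ℝ φ z (0, v) = inner ℝ (g z) v) {z₀ : ℝ × E3}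
    (hz₀ : g z₀ ≠ 0) (hφ₀ : φ z₀ = 0) :
    ∃ I : ℝ × E3 × ℝ → ℝ × E3 × ℝ, ContDiffAt ℝ ∞ I (z₀.1, z₀.2, 0) ∧
      I (z₀.1, z₀.2, 0) = (z₀.1, z₀.2, 0) ∧
      (∀ᶠ w in 𝓝 (z₀.1, z₀.2, (0 : ℝ)), I (w.1, w.2.1 + w.2.2 •
        (‖g (w.1, w.2.1)‖⁻¹ • g (w.1, w.2.1)), φ (w.1, w.2.1)) = w) ∧
      ∀ᶠ w in 𝓝 (z₀.1, z₀.2, (0 : ℝ)), ((I w).1, (I w).2.1 + (I w).2.2 •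
        (‖g ((I w).1, (I w).2.1)‖⁻¹ • g ((I w).1, (I w).2.1)), φ ((I w).1, (I w).2.1)) = w := by
  set n : ℝ × E3 → E3 := fun z => ‖g z‖⁻¹ • g z with hn
  have hns : ContDiffAt ℝ ∞ n z₀ :=
    ((hg.contDiffAt.norm ℝ hz₀).inv (norm_ne_zero_iff.mpr hz₀)).smul hg.contDiffAt
  set G : ℝ × E3 × ℝ → ℝ × E3 × ℝ :=
    fun w => (w.1, w.2.1 + w.2.2 • n (w.1, w.2.1), φ (w.1, w.2.1)) with hG
  set w₀ : ℝ × E3 × ℝ := (z₀.1, z₀.2, 0) with hw₀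
  have hq : ContDiff ℝ ∞ fun w : ℝ × E3 × ℝ => (w.1, w.2.1) :=
    contDiff_fst.prodMk (contDiff_fst.comp contDiff_snd)
  have hr : ContDiff ℝ ∞ fun w : ℝ × E3 × ℝ => w.2.2 := contDiff_snd.comp contDiff_snd
  have hnq : ContDiffAt ℝ ∞ (fun w : ℝ × E3 × ℝ => n (w.1, w.2.1)) w₀ :=
    ContDiffAt.comp (g := n) (f := fun w : ℝ × E3 × ℝ => (w.1, w.2.1)) w₀ hns hq.contDiffAt
  have hGs : ContDiffAt ℝ ∞ G w₀ :=
    contDiffAt_fst.prodMk (((contDiff_fst.comp contDiff_snd).contDiffAt.add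
      (hr.contDiffAt.smul hnq)).prodMk (hφ.comp hq).contDiffAt)
  have hGw : G w₀ = w₀ := by
    simp [hG, hw₀, hφ₀]
  have hfst : HasFDerivAt (fun w : ℝ × E3 × ℝ => w.1) (ContinuousLinearMap.fst ℝ ℝ (E3 × ℝ)) w₀ :=
    hasFDerivAt_fst
  have hmid : HasFDerivAt (fun w : ℝ × E3 × ℝ => w.2.1)
      ((ContinuousLinearMap.fst ℝ E3 ℝ).comp (ContinuousLinearMap.snd ℝ ℝ (E3 × ℝ))) w₀ :=
    ((ContinuousLinearMap.fst ℝ E3 ℝ).comp (ContinuousLinearMap.snd ℝ ℝ (E3 × ℝ))).hasFDerivAt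
  have hlast : HasFDerivAt (fun w : ℝ × E3 × ℝ => w.2.2)
      ((ContinuousLinearMap.snd ℝ E3 ℝ).comp (ContinuousLinearMap.snd ℝ ℝ (E3 × ℝ))) w₀ :=
    ((ContinuousLinearMap.snd ℝ E3 ℝ).comp (ContinuousLinearMap.snd ℝ ℝ (E3 × ℝ))).hasFDerivAt
  have hnd := (hnq.differentiableAt (by simp)).hasFDerivAt
  have hφd : HasFDerivAt φ (fderiv ℝ φ z₀) (w₀.1, w₀.2.1) :=
    (hφ.differentiable (by simp) z₀).hasFDerivAt
  have hφq := HasFDerivAt.comp w₀ (f := fun w : ℝ × E3 × ℝ => (w.1, w.2.1)) hφd (hfst.prodMk hmid)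
  have hGd := hfst.prodMk ((hmid.add (hlast.smul hnd)).prodMk hφq)
  obtain ⟨I, h1, h2, h3, h4⟩ := hGs.exists_local_inverse hGd (by
    rw [injective_iff_map_eq_zero]
    rintro ⟨τ, a, b⟩ h0
    simp only [ContinuousLinearMap.prod_apply, ContinuousLinearMap.coe_fst', add_apply,
      ContinuousLinearMap.comp_apply, ContinuousLinearMap.coe_snd', smul_apply,
      ContinuousLinearMap.smulRight_apply, Prod.mk_eq_zero] at h0
    obtain ⟨rfl, h5, h6⟩ := h0
    rw [hφg] at h6
    -- A kernel vector has `a = -b n`; as `g` is a positive multiple of `n`, the derivative of the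
    -- last coordinate becomes `-b * ‖g‖`, which forces `b = 0`.
    have h7 : a = -(b • n z₀) := by
      rw [eq_neg_iff_add_eq_zero]
      simpa [hw₀] using h5
    have h8 : inner ℝ (g z₀) (n z₀) = ‖g z₀‖ := by
      rw [hn, inner_smul_right, real_inner_self_eq_norm_sq]
      field_simp
    rw [h7, inner_neg_right, inner_smul_right, h8, neg_eq_zero, mul_eq_zero] at h6
    have hb : b = 0 := h6.resolve_right (norm_ne_zero_iff.mpr hz₀)
    rw [hb, zero_smul, neg_zero] at h7
    rw [h7, hb]; rfl)
  rw [hGw] at h1 h2 h4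
  exact ⟨I, h1, h2, h3, h4⟩

/-- The closest point mapping and the normal field are smooth near the moving surface. -/
theorem exists_tubular_chart {t₀ : ℝ} (ht₀ : t₀ ∈ Ioo 0 T) {y₀ : E3} (hy₀ : y₀ ∈ Γ.carrier t₀) :
    ContDiffAt ℝ ∞ (fun z : ℝ × E3 => Γ.closestPoint z.1 z.2) (t₀, y₀) ∧
    ContDiffAt ℝ ∞ (fun z : ℝ × E3 => Γ.normal z.1 (Γ.closestPoint z.1 z.2)) (t₀, y₀) ∧
    (∀ᶠ z in 𝓝 (t₀, y₀), z.2 = Γ.closestPoint z.1 z.2 +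
      Γ.signedDist z.1 z.2 • Γ.normal z.1 (Γ.closestPoint z.1 z.2)) ∧
    ∀ᶠ w in 𝓝 (t₀, y₀, (0 : ℝ)), w.2.1 ∈ Γ.carrier w.1 → ‖Γ.normal w.1 w.2.1‖ = 1 ∧
      Γ.closestPoint w.1 (w.2.1 + w.2.2 • Γ.normal w.1 w.2.1) = w.2.1 := by
  obtain ⟨φ, g, hφ, hg, hφg, hgood⟩ := Γ.exists_defining_gradient ht₀ hy₀
  have hz₀ := hgood.self_of_nhds
  have hg₀ : g (t₀, y₀) ≠ 0 := hz₀.2.2.1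
  have hφ₀ : φ (t₀, y₀) = 0 := hz₀.2.1.mp hy₀
  obtain ⟨I, hI, hI₀, hIl, hIr⟩ := exists_tubular_inverse hφ hg hφg hg₀ hφ₀
  simp only at hI hI₀ hIl hIr
  set z₀ : ℝ × E3 := (t₀, y₀) with hz₀def
  set n : ℝ × E3 → E3 := fun z => ‖g z‖⁻¹ • g z with hn
  have hns : ContDiffAt ℝ ∞ n z₀ :=
    ((hg.contDiffAt.norm ℝ hg₀).inv (norm_ne_zero_iff.mpr hg₀)).smul hg.contDiffAt
  have hn1 : ∀ z, g z ≠ 0 → ‖n z‖ = 1 := fun z hz => by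
    rw [hn, norm_smul, norm_inv, norm_norm, inv_mul_cancel₀ (norm_ne_zero_iff.mpr hz)]
  -- The candidate for the closest point: invert the tubular coordinates with defining-function
  -- value `0`, so that the foot lies on the surface.
  set π : ℝ × E3 → E3 := fun z => (I (z.1, z.2, 0)).2.1 with hπ
  have hι : ContDiff ℝ ∞ fun z : ℝ × E3 => (z.1, z.2, (0 : ℝ)) :=
    contDiff_fst.prodMk (contDiff_snd.prodMk contDiff_const)
  have hIι : ContDiffAt ℝ ∞ (fun z : ℝ × E3 => I (z.1, z.2, 0)) z₀ :=
    ContDiffAt.comp (g := I) (f := fun z : ℝ × E3 => (z.1, z.2, (0 : ℝ))) z₀ hI hι.contDiffAt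
  have hπs : ContDiffAt ℝ ∞ π z₀ := (contDiff_fst.comp contDiff_snd).contDiffAt.comp z₀ hIι
  have hπ₀ : π z₀ = y₀ := by simp [hπ, hz₀def, hI₀]
  have hιt : Tendsto (fun z : ℝ × E3 => (z.1, z.2, (0 : ℝ))) (𝓝 z₀) (𝓝 (t₀, y₀, 0)) :=
    hι.continuous.tendsto z₀
  have hIt : Tendsto (fun z : ℝ × E3 => ((I (z.1, z.2, 0)).1, (I (z.1, z.2, 0)).2.1)) (𝓝 z₀)
      (𝓝 z₀) := by
    have h1 : ContinuousAt (fun z : ℝ × E3 => ((I (z.1, z.2, 0)).1, (I (z.1, z.2, 0)).2.1)) z₀ :=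
      (continuous_fst.continuousAt.comp hIι.continuousAt).prodMk hπs.continuousAt
    have h2 := h1.tendsto
    simp only [hz₀def, hI₀] at h2
    exact h2
  have hT : ∀ᶠ z : ℝ × E3 in 𝓝 z₀, z.1 ∈ Icc 0 T :=
    hgood.mono fun z hz => Ioo_subset_Icc_self hz.1
  have hπmem : ∀ᶠ z in 𝓝 z₀, π z ∈ Γ.carrier z.1 := by
    filter_upwards [hιt.eventually hIr, hIt.eventually hgood] with z h1 h2
    have h3 : (I (z.1, z.2, 0)).1 = z.1 := congrArg Prod.fst h1
    have h4 := h2.2.1.mpr (congrArg (fun w => w.2.2) h1)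
    simp only [h3] at h4
    exact h4
  -- The candidate is a competitor in the minimization, so the chosen closest point also tends to
  -- `y₀` and the local description of the surface applies to it.
  have hcdist : ∀ᶠ z in 𝓝 z₀, dist z.2 (Γ.closestPoint z.1 z.2) ≤ dist z.2 (π z) := by
    filter_upwards [hT, hπmem] with z h1 h2 using Γ.dist_closestPoint_le h1 z.2 h2
  have hπd : Tendsto (fun z : ℝ × E3 => dist z.2 (π z)) (𝓝 z₀) (𝓝 0) := by
    have h2 : Tendsto (fun z : ℝ × E3 => dist z.2 (π z)) (𝓝 z₀) (𝓝 (dist z₀.2 (π z₀))) :=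
      (continuous_snd.tendsto z₀).dist hπs.continuousAt.tendsto
    rw [hπ₀, hz₀def, dist_self] at h2
    exact h2
  have hcd : Tendsto (fun z : ℝ × E3 => dist z.2 (Γ.closestPoint z.1 z.2)) (𝓝 z₀) (𝓝 0) :=
    squeeze_zero' (Eventually.of_forall fun _ => dist_nonneg) hcdist hπd
  have hct : Tendsto (fun z : ℝ × E3 => (z.1, Γ.closestPoint z.1 z.2)) (𝓝 z₀) (𝓝 z₀) := by
    have h1 : Tendsto (fun z : ℝ × E3 => Γ.closestPoint z.1 z.2) (𝓝 z₀) (𝓝 y₀) := by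
      have h2 : Tendsto (fun z : ℝ × E3 => z.2) (𝓝 z₀) (𝓝 y₀) := continuous_snd.tendsto z₀
      exact h2.congr_dist hcd
    exact (continuous_fst.tendsto z₀).prodMk_nhds h1
  have hnormal : ∀ᶠ z in 𝓝 z₀, Γ.normal z.1 (Γ.closestPoint z.1 z.2) =
      n (z.1, Γ.closestPoint z.1 z.2) ∧ ‖n (z.1, Γ.closestPoint z.1 z.2)‖ = 1 := by
    filter_upwards [hT, hct.eventually hgood] with z h1 h2
    exact ⟨h2.2.2.2 (Γ.closestPoint_spec h1 z.2).1, hn1 _ h2.2.2.1⟩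
  have hdec : ∀ᶠ z in 𝓝 z₀, z.2 = Γ.closestPoint z.1 z.2 +
      Γ.signedDist z.1 z.2 • Γ.normal z.1 (Γ.closestPoint z.1 z.2) := by
    filter_upwards [hT, hct.eventually hgood.eventually_nhds, hnormal] with z h1 h2 h3
    set y := Γ.closestPoint z.1 z.2 with hy
    obtain ⟨hyC, -⟩ := Γ.closestPoint_spec h1 z.2
    have h4 := h2.self_of_nhds
    have hsd : HasStrictFDerivAt (fun x => φ (z.1, x))
        ((fderiv ℝ φ (z.1, y)).comp (ContinuousLinearMap.inr ℝ ℝ E3)) y := by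
      have h5 : HasStrictFDerivAt φ (fderiv ℝ φ (z.1, y)) (z.1, y) :=
        hφ.contDiffAt.hasStrictFDerivAt (by simp)
      exact h5.comp y ((hasStrictFDerivAt_const z.1 y).prodMk (hasStrictFDerivAt_id y))
    have hloc : ∀ᶠ y' in 𝓝 y, φ (z.1, y') = 0 → y' ∈ Γ.carrier z.1 := by
      have hc : Tendsto (fun y' : E3 => (z.1, y')) (𝓝 y) (𝓝 (z.1, y)) :=
        (Continuous.prodMk_right z.1).tendsto y
      filter_upwards [hc.eventually h2] with y' hy' using hy'.2.1.mpr
    -- Minimality makes `x - y` a multiple of the gradient, hence of the normal; the multiple is the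
    -- signed distance.
    obtain ⟨c, hc⟩ := exists_sub_eq_smul_of_isMin (S := Γ.carrier z.1) (x := z.2) hsd
      (fun v => by simpa using hφg (z.1, y) v) h4.2.2.1 (h4.2.1.mp hyC) hloc
      (fun y' hy' => Γ.dist_closestPoint_le h1 z.2 hy')
    have hgn : g (z.1, y) = ‖g (z.1, y)‖ • n (z.1, y) := by
      rw [hn, smul_smul, mul_inv_cancel₀ (norm_ne_zero_iff.mpr h4.2.2.1), one_smul]
    rw [hgn, smul_smul] at hc
    have hs : Γ.signedDist z.1 z.2 = c * ‖g (z.1, y)‖ := by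
      rw [signedDist, ← hy, h3.1, hc, real_inner_smul_left, real_inner_self_eq_norm_sq, h3.2]
      ring
    rw [hs, h3.1, ← hc]; abel
  have hst : Tendsto (fun z : ℝ × E3 => Γ.signedDist z.1 z.2) (𝓝 z₀) (𝓝 0) := by
    refine squeeze_zero_norm' ?_ hcd
    filter_upwards [hnormal] with z hz
    rw [signedDist, dist_eq_norm]
    refine (norm_inner_le_norm _ _).trans ?_
    rw [hz.1, hz.2, mul_one]
  have hwt : Tendsto (fun z : ℝ × E3 => (z.1, Γ.closestPoint z.1 z.2, Γ.signedDist z.1 z.2))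
      (𝓝 z₀) (𝓝 (t₀, y₀, 0)) :=
    (continuous_fst.tendsto z₀).prodMk_nhds (((continuous_snd.tendsto z₀).comp hct).prodMk_nhds hst)
  -- Any closest point, with its signed distance, gives tubular coordinates of `x`. Local
  -- invertibility then forces it to be `π`, which proves uniqueness and smoothness together.
  have hcπ : ∀ᶠ z in 𝓝 z₀, Γ.closestPoint z.1 z.2 = π z := by
    filter_upwards [hT, hct.eventually hgood, hnormal, hdec, hwt.eventually hIl]
      with z h1 h2 h3 h4 h5
    rw [h3.1] at h4
    have h6 : φ (z.1, Γ.closestPoint z.1 z.2) = 0 := h2.2.1.mp (Γ.closestPoint_spec h1 z.2).1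
    simp only [h6] at h5
    rw [← h4] at h5
    simp only [hπ, h5]
  have hcs : ContDiffAt ℝ ∞ (fun z : ℝ × E3 => Γ.closestPoint z.1 z.2) z₀ :=
    hπs.congr_of_eventuallyEq hcπ
  refine ⟨hcs, ?_, hdec, ?_⟩
  · have h1 : ContDiffAt ℝ ∞ (fun z : ℝ × E3 => n (z.1, π z)) z₀ := by
      refine ContDiffAt.comp (g := n) (f := fun z : ℝ × E3 => (z.1, π z)) z₀ ?_
        (contDiffAt_fst.prodMk hπs)
      rw [hπ₀]; exact hns
    refine h1.congr_of_eventuallyEq ?_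
    filter_upwards [hcπ, hnormal] with z h2 h3
    rw [h3.1, h2]
  · have hq : Tendsto (fun w : ℝ × E3 × ℝ => (w.1, w.2.1)) (𝓝 (t₀, y₀, 0)) (𝓝 z₀) := by
      have : Continuous fun w : ℝ × E3 × ℝ => (w.1, w.2.1) := by fun_prop
      exact this.tendsto (t₀, y₀, 0)
    have hx : Tendsto (fun w : ℝ × E3 × ℝ => (w.1, w.2.1 + w.2.2 • n (w.1, w.2.1)))
        (𝓝 (t₀, y₀, 0)) (𝓝 z₀) := by
      have h1 : Tendsto (fun w : ℝ × E3 × ℝ => n (w.1, w.2.1)) (𝓝 (t₀, y₀, 0)) (𝓝 (n z₀)) :=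
        hns.continuousAt.tendsto.comp hq
      have h2 : Tendsto (fun w : ℝ × E3 × ℝ => w.2.2) (𝓝 (t₀, y₀, 0)) (𝓝 (0 : ℝ)) :=
        (continuous_snd.comp continuous_snd).tendsto (t₀, y₀, (0 : ℝ))
      have h3 : Tendsto (fun w : ℝ × E3 × ℝ => w.2.1) (𝓝 (t₀, y₀, 0)) (𝓝 y₀) :=
        (continuous_fst.comp continuous_snd).tendsto (t₀, y₀, (0 : ℝ))
      have h4 := h3.add (h2.smul h1)
      rw [zero_smul, add_zero] at h4
      exact (continuous_fst.tendsto (t₀, y₀, (0 : ℝ))).prodMk_nhds h4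
    filter_upwards [hq.eventually hgood, hx.eventually hcπ, hIl] with w h1 h2 h3 hw
    have h4 : Γ.normal w.1 w.2.1 = n (w.1, w.2.1) := h1.2.2.2 hw
    have h5 : φ (w.1, w.2.1) = 0 := h1.2.1.mp hw
    rw [h5] at h3
    refine ⟨by rw [h4]; exact hn1 _ h1.2.2.1, ?_⟩
    rw [h4, h2]
    simp only [hπ, hn]
    rw [h3]

end OrientedMovingSurface

/-! ### Uniform tubes and bounds on compact time intervals -/

theorem normalVelocity_eq {M : ℝ → Set E3} {n : ℝ → E3 → E3} {t : ℝ} {y : E3} {c : ℝ}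
    (hc : ∀ γ : ℝ → E3, (∀ᶠ s in 𝓝 t, γ s ∈ M s) → γ t = y → DifferentiableAt ℝ γ t →
      inner ℝ (deriv γ t) (n t y) = c)
    (hex : ∃ γ : ℝ → E3, (∀ᶠ s in 𝓝 t, γ s ∈ M s) ∧ γ t = y ∧ DifferentiableAt ℝ γ t) :
    normalVelocity M n t y = c := by
  obtain ⟨γ, h1, h2, h3⟩ := hex
  have hspec := Classical.epsilon_spec (p := fun c : ℝ => ∀ γ : ℝ → E3, (∀ᶠ s in 𝓝 t, γ s ∈ M s) →
    γ t = y → DifferentiableAt ℝ γ t → inner ℝ (deriv γ t) (n t y) = c) ⟨c, hc⟩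
  exact (hspec γ h1 h2 h3).symm.trans (hc γ h1 h2 h3)

namespace OrientedMovingSurface

variable {T : ℝ} (Γ : OrientedMovingSurface T)

theorem contDiffAt_closestPoint {z : ℝ × E3} (hz : z ∈ Γ.spaceTime) :
    ContDiffAt ℝ 2 (fun z : ℝ × E3 => Γ.closestPoint z.1 z.2) z :=
  (Γ.exists_tubular_chart hz.1 hz.2).1.of_le (by norm_cast)

theorem contDiffAt_normal {z : ℝ × E3} (hz : z ∈ Γ.spaceTime) :
    ContDiffAt ℝ 2 (fun z : ℝ × E3 => Γ.normal z.1 (Γ.closestPoint z.1 z.2)) z :=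
  (Γ.exists_tubular_chart hz.1 hz.2).2.1.of_le (by norm_cast)

theorem norm_normal {z : ℝ × E3} (hz : z ∈ Γ.spaceTime) : ‖Γ.normal z.1 z.2‖ = 1 :=
  ((Γ.exists_tubular_chart hz.1 hz.2).2.2.2.self_of_nhds hz.2).1

theorem contDiffAt_slice {F : ℝ × E3 → E3} {z : ℝ × E3} (hF : ContDiffAt ℝ 2 F z) :
    ContDiffAt ℝ 1 (fun x => F (z.1, x)) z.2 :=
  (ContDiffAt.comp (g := F) (f := fun x : E3 => (z.1, x)) z.2 hF
    (contDiffAt_const.prodMk contDiffAt_id)).of_le (by norm_num)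

theorem fderiv_slice {F : ℝ × E3 → E3} {z : ℝ × E3} (hF : ContDiffAt ℝ 2 F z) :
    fderiv ℝ (fun x => F (z.1, x)) z.2 =
      (fderiv ℝ F z).comp (ContinuousLinearMap.inr ℝ ℝ E3) := by
  have h1 : HasFDerivAt F (fderiv ℝ F z) (z.1, z.2) :=
    (hF.differentiableAt (by norm_num)).hasFDerivAt
  exact (h1.comp z.2 (hasFDerivAt_prodMk_right z.1 z.2)).fderiv

theorem slab_subset_spaceTime {a b : ℝ} (ha : 0 < a) (hb : b < T) :
    {z : ℝ × E3 | z.1 ∈ Icc a b ∧ z.2 ∈ Γ.carrier z.1} ⊆ Γ.spaceTime :=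
  fun _ hz => ⟨⟨ha.trans_le hz.1.1, hz.1.2.trans_lt hb⟩, hz.2⟩

theorem exists_shape_bound {a b : ℝ} (ha : 0 < a) (hb : b < T) :
    ∃ C, ∀ t ∈ Icc a b, ∀ y ∈ Γ.carrier t,
      ‖shape (Γ.normal t) (Γ.closestPoint t) y‖ ≤ C := by
  obtain ⟨C, hC⟩ := (Γ.isCompact_slab ha.le hb.le).exists_bound_of_continuousOn
    (f := fun z => (fderiv ℝ (fun z : ℝ × E3 => Γ.normal z.1 (Γ.closestPoint z.1 z.2)) z).comp
      (ContinuousLinearMap.inr ℝ ℝ E3)) (by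
    intro z hz
    have h1 := (Γ.contDiffAt_normal (Γ.slab_subset_spaceTime ha hb hz)).fderiv_right (m := 1)
      (by norm_num)
    exact (h1.continuousAt.clm_comp continuousAt_const).continuousWithinAt)
  refine ⟨C, fun t ht y hy => ?_⟩
  have hz : (t, y) ∈ {z : ℝ × E3 | z.1 ∈ Icc a b ∧ z.2 ∈ Γ.carrier z.1} := ⟨ht, hy⟩
  have h1 := fderiv_slice (Γ.contDiffAt_normal (Γ.slab_subset_spaceTime ha hb hz))
  have h2 := hC _ hz
  rw [← h1] at h2
  exact h2

/-- Tubular neighbourhoods of radius independent of time, on compact time intervals. -/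
theorem exists_isTube {a b : ℝ} (ha : 0 < a) (hb : b < T) :
    ∃ ρ > 0, ∀ t ∈ Icc a b, IsTube (Γ.carrier t) (Γ.normal t) (Γ.closestPoint t) ρ := by
  set K := {z : ℝ × E3 | z.1 ∈ Icc a b ∧ z.2 ∈ Γ.carrier z.1} with hK
  have hKc : IsCompact K := Γ.isCompact_slab ha.le hb.le
  have hKS : K ⊆ Γ.spaceTime := Γ.slab_subset_spaceTime ha hb
  obtain ⟨C, hC⟩ := Γ.exists_shape_bound ha hb
  obtain ⟨ρ₁, hρ₁, h1⟩ := hKc.exists_radius (Q := fun z => z.2 = Γ.closestPoint z.1 z.2 +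
      Γ.signedDist z.1 z.2 • Γ.normal z.1 (Γ.closestPoint z.1 z.2) ∧
      ContDiffAt ℝ 2 (fun z : ℝ × E3 => Γ.closestPoint z.1 z.2) z) (fun z hz =>
    (Γ.exists_tubular_chart (hKS hz).1 (hKS hz).2).2.2.1.and
      ((Γ.contDiffAt_closestPoint (hKS hz)).eventually (by simp)))
  have hι : Continuous fun z : ℝ × E3 => (z.1, z.2, (0 : ℝ)) := by fun_prop
  obtain ⟨ρ₂, hρ₂, h2⟩ := (hKc.image hι).exists_radius
    (Q := fun w => w.2.1 ∈ Γ.carrier w.1 → ‖Γ.normal w.1 w.2.1‖ = 1 ∧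
      Γ.closestPoint w.1 (w.2.1 + w.2.2 • Γ.normal w.1 w.2.1) = w.2.1) (by
    rintro _ ⟨z, hz, rfl⟩
    exact (Γ.exists_tubular_chart (hKS hz).1 (hKS hz).2).2.2.2)
  have hCpos : 0 < 2 * (|C| + 1) := by positivity
  -- `ρ₁` secures the decomposition and the regularity of the projection, `ρ₂` the retraction along
  -- normals, and the last radius the smallness `ρ * ‖W‖ ≤ 1 / 2`.
  refine ⟨min (min ρ₁ ρ₂) (2 * (|C| + 1))⁻¹,
    lt_min (lt_min hρ₁ hρ₂) (inv_pos.mpr hCpos), fun t ht => ?_⟩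
  have htT : t ∈ Icc 0 T := ⟨ha.le.trans ht.1, ht.2.trans hb.le⟩
  have hcp := Γ.closestPoint_spec htT
  have hnear : ∀ x, Metric.infDist x (Γ.carrier t) < min (min ρ₁ ρ₂) (2 * (|C| + 1))⁻¹ →
      dist (t, x) (t, Γ.closestPoint t x) < ρ₁ := by
    intro x hx
    rw [dist_prod_same_left, (hcp x).2]
    exact hx.trans_le ((min_le_left _ _).trans (min_le_left _ _))
  constructor
  · exact Γ.isCompact_carrier htT
  · exact lt_min (lt_min hρ₁ hρ₂) (inv_pos.mpr hCpos)
  · exact fun x => (hcp x).1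
  · exact fun x => (hcp x).2
  · exact fun y hy => Γ.norm_normal (z := (t, y)) (hKS ⟨ht, hy⟩)
  · intro y hy r hr
    refine (h2 (t, y, 0) ⟨(t, y), ⟨ht, hy⟩, rfl⟩ (t, y, r) ?_ hy).2
    rw [dist_prod_same_left, dist_prod_same_left, dist_zero_right, Real.norm_eq_abs]
    exact hr.trans_le ((min_le_left _ _).trans (min_le_right _ _))
  · exact fun x hx => (h1 (t, Γ.closestPoint t x) ⟨ht, (hcp x).1⟩ (t, x) (hnear x hx)).1
  · exact fun y hy => contDiffAt_slice (z := (t, y)) (Γ.contDiffAt_closestPoint (hKS ⟨ht, hy⟩))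
  · exact fun y hy => contDiffAt_slice (z := (t, y)) (Γ.contDiffAt_normal (hKS ⟨ht, hy⟩))
  · intro x hx
    rw [Metric.mem_thickening_iff_infDist_lt (Γ.nonempty_carrier htT)] at hx
    have h3 := (h1 (t, Γ.closestPoint t x) ⟨ht, (hcp x).1⟩ (t, x) (hnear x hx)).2
    exact (contDiffAt_slice h3).continuousAt.continuousWithinAt
  · intro y hy
    have h3 : ‖fderiv ℝ (fun x => Γ.normal t (Γ.closestPoint t x)) y‖ ≤ |C| + 1 :=
      (hC t ht y hy).trans ((le_abs_self C).trans (by linarith))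
    calc _ ≤ (2 * (|C| + 1))⁻¹ * (|C| + 1) :=
          mul_le_mul (min_le_right _ _) h3 (norm_nonneg _) (inv_pos.mpr hCpos).le
      _ = 1 / 2 := by field_simp

theorem fderiv_closestPoint {z : ℝ × E3} (hz : z ∈ Γ.spaceTime) (v : E3) :
    fderiv ℝ (fun z : ℝ × E3 => Γ.closestPoint z.1 z.2) z (0, v) =
      tangentProj (Γ.normal z.1 z.2) v := by
  obtain ⟨ρ, hρ, htube⟩ := Γ.exists_isTube hz.1.1 hz.1.2
  have e1 := (htube z.1 ⟨le_rfl, le_rfl⟩).fderiv_proj hz.2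
  have e2 := fderiv_slice (Γ.contDiffAt_closestPoint hz)
  rw [← e1]
  exact (congrArg (fun L : E3 →L[ℝ] E3 => L v) e2).symm

/-- Uniform area bound on compact time intervals. -/
theorem exists_area_bound {a b : ℝ} (ha : 0 < a) (hb : b < T) :
    ∃ C : ENNReal, C ≠ ⊤ ∧ ∀ t ∈ Icc a b, μHE[2] (Γ.carrier t) ≤ C := by
  set K := {z : ℝ × E3 | z.1 ∈ Icc a b ∧ z.2 ∈ Γ.carrier z.1} with hK
  have hKc : IsCompact K := Γ.isCompact_slab ha.le hb.le
  have hKS : K ⊆ Γ.spaceTime := Γ.slab_subset_spaceTime ha hb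
  obtain ⟨ρ, hρ, htube⟩ := Γ.exists_isTube ha hb
  -- The repeated condition is the case `s = K` of the property used in the compactness induction
  -- over space-time subsets `s`.
  suffices H : ∃ C : ENNReal, C ≠ ⊤ ∧ ∀ t, μHE[2] {y | (t, y) ∈ K ∧ (t, y) ∈ K} ≤ C by
    obtain ⟨C, hC, h1⟩ := H
    refine ⟨C, hC, fun t ht =>
      (measure_mono (t := {y | (t, y) ∈ K ∧ (t, y) ∈ K}) ?_).trans (h1 t)⟩
    exact fun y hy => ⟨⟨ht, hy⟩, ⟨ht, hy⟩⟩
  refine hKc.induction_on (p := fun s => ∃ C : ENNReal, C ≠ ⊤ ∧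
    ∀ t, μHE[2] {y | (t, y) ∈ s ∧ (t, y) ∈ K} ≤ C) ⟨0, by simp, by simp⟩ ?_ ?_ ?_
  · rintro s s' hs ⟨C, hC, h1⟩
    refine ⟨C, hC, fun t => (measure_mono (t := {y | (t, y) ∈ s' ∧ (t, y) ∈ K}) ?_).trans (h1 t)⟩
    exact fun y hy => ⟨hs hy.1, hy.2⟩
  · rintro s s' ⟨C, hC, h1⟩ ⟨C', hC', h1'⟩
    refine ⟨C + C', by simp [hC, hC'], fun t => ?_⟩
    refine (measure_mono (t := {y | (t, y) ∈ s ∧ (t, y) ∈ K} ∪ {y | (t, y) ∈ s' ∧ (t, y) ∈ K})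
      ?_).trans ((measure_union_le _ _).trans (add_le_add (h1 t) (h1' t)))
    rintro y ⟨hy | hy, hyK⟩
    · exact Or.inl ⟨hy, hyK⟩
    · exact Or.inr ⟨hy, hyK⟩
  · intro z₀ hz₀
    have hcd := Γ.contDiffAt_closestPoint (hKS hz₀)
    -- Strict differentiability in space-time compares all nearby time slices with one fixed tangent
    -- plane. The closest point map is the identity on a slice, so the projection to that plane
    -- shrinks distances by at most a factor `2`.
    have hs := hcd.hasStrictFDerivAt (by norm_num)
    have h1 := (hasStrictFDerivAt_iff_isLittleO.mp hs).bound (show (0 : ℝ) < 1 / 2 by norm_num)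
    rw [nhds_prod_eq] at h1
    obtain ⟨U, hU, hUb⟩ := mem_prod_same_iff.mp h1
    set n₀ := Γ.normal z₀.1 z₀.2 with hn₀
    have hD : ∀ v : E3, fderiv ℝ (fun z : ℝ × E3 => Γ.closestPoint z.1 z.2) z₀ (0, v) =
        tangentProj n₀ v := Γ.fderiv_closestPoint (hKS hz₀)
    have hn₀1 : ‖n₀‖ = 1 := Γ.norm_normal (hKS hz₀)
    refine ⟨U ∩ Metric.ball z₀ 1, mem_nhdsWithin_of_mem_nhds
      (inter_mem hU (Metric.ball_mem_nhds _ one_pos)),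
      (2 : NNReal) ^ 2 * μHE[2] (tangentProj n₀ '' Metric.ball z₀.2 1), ?_, fun t => ?_⟩
    · refine ENNReal.mul_ne_top (by simp)
        (euclideanHausdorffMeasure_two_lt_top hn₀1 ?_ ?_).ne
      · rintro _ ⟨x, -, rfl⟩
        exact inner_tangentProj hn₀1 x
      · exact ((isCompact_closedBall z₀.2 1).image (tangentProj n₀).continuous).isBounded.subset
          (image_mono Metric.ball_subset_closedBall)
    · have h2 := euclideanHausdorffMeasure_image_le 2 (f := id) (g := tangentProj n₀)
        (A := {y | (t, y) ∈ U ∩ Metric.ball z₀ 1 ∧ (t, y) ∈ K}) (K := 2) (by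
        rintro y ⟨hy, hyK⟩ y' ⟨hy', hyK'⟩
        have h3 := hUb (mk_mem_prod hy.1 hy'.1)
        simp only [mem_ofPred_eq] at h3
        have htb := htube t hyK.1
        rw [htb.proj_self hyK.2, htb.proj_self hyK'.2, Prod.mk_sub_mk, sub_self, hD] at h3
        have h4 : ‖((0 : ℝ), y - y')‖ = ‖y - y'‖ := by
          rw [Prod.norm_mk, norm_zero]; exact max_eq_right (norm_nonneg _)
        rw [h4] at h3
        have h5 := norm_sub_norm_le (y - y') (tangentProj n₀ (y - y'))
        rw [id, id, dist_eq_norm, dist_eq_norm, ← map_sub, NNReal.coe_ofNat]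
        linarith)
      rw [image_id] at h2
      refine h2.trans (mul_le_mul_right (measure_mono (image_mono ?_)) _)
      rintro y ⟨hy, -⟩
      have := hy.2
      rw [Metric.mem_ball, Prod.dist_eq] at this
      exact (le_max_right _ _).trans_lt this

/-! ### Velocities and curvature -/

theorem closestPoint_self {t : ℝ} (ht : t ∈ Icc 0 T) {y : E3} (hy : y ∈ Γ.carrier t) :
    Γ.closestPoint t y = y := by
  have := (Γ.closestPoint_spec ht y).2
  rw [Metric.infDist_zero_of_mem hy] at this
  exact (dist_eq_zero.mp this).symm

/-- A curve on the moving surface satisfies `γ s = π(γ s, s)`. Differentiation writes `γ'` as the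
time derivative of `π` plus the tangential part of `γ'`, and the latter is orthogonal to the normal.
-/
theorem surfaceVelocity_spec {t : ℝ} (ht : t ∈ Ioo 0 T) {y : E3} (hy : y ∈ Γ.carrier t) :
    Γ.surfaceVelocity t y = inner ℝ
      (fderiv ℝ (fun z : ℝ × E3 => Γ.closestPoint z.1 z.2) (t, y) (1, 0)) (Γ.normal t y) := by
  have hz : (t, y) ∈ Γ.spaceTime := ⟨ht, hy⟩
  have hd : HasFDerivAt (fun z : ℝ × E3 => Γ.closestPoint z.1 z.2)
      (fderiv ℝ (fun z : ℝ × E3 => Γ.closestPoint z.1 z.2) (t, y)) (t, y) :=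
    ((Γ.contDiffAt_closestPoint hz).differentiableAt (by norm_num)).hasFDerivAt
  have hT : ∀ᶠ s in 𝓝 t, s ∈ Icc 0 T := Icc_mem_nhds ht.1 ht.2
  refine normalVelocity_eq (fun γ h1 h2 h3 => ?_) ⟨fun s => Γ.closestPoint s y, ?_, ?_, ?_⟩
  · have h4 : HasDerivAt (fun s => (s, γ s)) (1, deriv γ t) t :=
      (hasDerivAt_id t).prodMk h3.hasDerivAt
    have h5 := HasFDerivAt.comp_hasDerivAt (f := fun s => (s, γ s)) t (by rw [h2]; exact hd) h4
    have h6 : HasDerivAt γ (fderiv ℝ (fun z : ℝ × E3 => Γ.closestPoint z.1 z.2) (t, y)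
        (1, deriv γ t)) t := by
      refine h5.congr_of_eventuallyEq ?_
      filter_upwards [h1, hT] with s hs hsT using (Γ.closestPoint_self hsT hs).symm
    have h7 : ((1 : ℝ), deriv γ t) = (1, 0) + (0, deriv γ t) := by simp
    have h8 := h6.deriv
    rw [h7, map_add, Γ.fderiv_closestPoint hz] at h8
    rw [h8, inner_add_left, real_inner_comm _ (tangentProj _ _),
      inner_tangentProj (Γ.norm_normal hz), add_zero]
  · filter_upwards [hT] with s hs using (Γ.closestPoint_spec hs y).1
  · exact Γ.closestPoint_self (Ioo_subset_Icc_self ht) hy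
  · exact (HasFDerivAt.comp_hasDerivAt (f := fun s => (s, y)) t hd
      ((hasDerivAt_id t).prodMk (hasDerivAt_const t y))).differentiableAt

/-- A curve through a given point of the moving surface, along which the normal is differentiable. -/
theorem exists_curve {t : ℝ} (ht : t ∈ Ioo 0 T) {y : E3} (hy : y ∈ Γ.carrier t) :
    ∃ η : ℝ → E3, (∀ᶠ s in 𝓝 t, η s ∈ Γ.carrier s) ∧ η t = y ∧ DifferentiableAt ℝ η t ∧
      DifferentiableAt ℝ (fun s => Γ.normal s (η s)) t ∧
      inner ℝ (deriv η t) (Γ.normal t y) = Γ.surfaceVelocity t y := by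
  have hz : (t, y) ∈ Γ.spaceTime := ⟨ht, hy⟩
  have hd := ((Γ.contDiffAt_closestPoint hz).differentiableAt (by norm_num)).hasFDerivAt
  have hdn := ((Γ.contDiffAt_normal hz).differentiableAt (by norm_num)).hasFDerivAt
  have hT : ∀ᶠ s in 𝓝 t, s ∈ Icc 0 T := Icc_mem_nhds ht.1 ht.2
  have hl : HasDerivAt (fun s => (s, y)) ((1 : ℝ), (0 : E3)) t :=
    (hasDerivAt_id t).prodMk (hasDerivAt_const t y)
  have h1 := HasFDerivAt.comp_hasDerivAt (f := fun s => (s, y)) t hd hl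
  have h2 := HasFDerivAt.comp_hasDerivAt (f := fun s => (s, y)) t hdn hl
  refine ⟨fun s => Γ.closestPoint s y, ?_, Γ.closestPoint_self (Ioo_subset_Icc_self ht) hy,
    h1.differentiableAt, h2.differentiableAt, ?_⟩
  · filter_upwards [hT] with s hs using (Γ.closestPoint_spec hs y).1
  · rw [Γ.surfaceVelocity_spec ht hy]
    exact congrArg (fun v => inner ℝ v (Γ.normal t y)) h1.deriv

/-- Let `γ` run in the boundary of the tube and `η` on the surface through the foot point. Then `‖γ
s - η s‖ ≥ ε` with equality at time `t`, so the squared distance has zero derivative there, and `γ'`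
and `η'` have the same normal component. The displaced curve `η + σ ε ν` shows that such a `γ`
exists. -/
theorem thinDomainVelocity_eq {a b ρ : ℝ} (ha : 0 < a) (hb : b < T)
    (htube : ∀ t ∈ Icc a b, IsTube (Γ.carrier t) (Γ.normal t) (Γ.closestPoint t) ρ)
    {t : ℝ} (ht : t ∈ Ioo a b) {y : E3} (hy : y ∈ Γ.carrier t) {ε : ℝ} (hε : 0 < ε) (hερ : ε < ρ)
    {σ : ℝ} (hσ : σ = 1 ∨ σ = -1) :
    Γ.thinDomainVelocity ε t (y + (σ * ε) • Γ.normal t y) = σ * Γ.surfaceVelocity t y := by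
  have htI := Ioo_subset_Icc_self ht
  have htT : t ∈ Ioo 0 T := ⟨ha.trans ht.1, ht.2.trans hb⟩
  have hI : ∀ᶠ s in 𝓝 t, s ∈ Icc a b := Icc_mem_nhds ht.1 ht.2
  have hσ2 : σ * σ = 1 := by rcases hσ with rfl | rfl <;> norm_num
  have hσa : |σ * ε| = ε := by
    rcases hσ with rfl | rfl <;> simp [abs_of_pos hε]
  have hσρ : |σ * ε| < ρ := by rwa [hσa]
  have htb := htube t htI
  obtain ⟨η, hη, hηt, hηd, hηn, hηv⟩ := Γ.exists_curve htT hy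
  have hnorm : Γ.thinDomainNormal t (y + (σ * ε) • Γ.normal t y) = σ • Γ.normal t y := by
    have h1 : Γ.signedDist t (y + (σ * ε) • Γ.normal t y) = σ * ε := htb.sdist_add hy hσρ
    rw [thinDomainNormal, h1, htb.proj_add y hy _ hσρ]
    rcases hσ with rfl | rfl
    · rw [if_pos (by linarith), one_smul]
    · rw [if_neg (by linarith), neg_one_smul]
  refine normalVelocity_eq (fun γ h1 h2 h3 => ?_)
    ⟨fun s => η s + (σ * ε) • Γ.normal s (η s), ?_, ?_, ?_⟩
  · have hmin : IsLocalMin (fun s => ‖γ s - η s‖ ^ 2) t := by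
      filter_upwards [h1, hη, hI] with s hs hs' hsI
      have h4 := Metric.frontier_thickening_subset (Γ.carrier s) hs
      have h5 : Metric.infDist (γ s) (Γ.carrier s) = ε := by
        rw [Metric.infDist, h4, ENNReal.toReal_ofReal hε.le]
      have h6 := Metric.infDist_le_dist_of_mem (x := γ s) hs'
      rw [h5, dist_eq_norm] at h6
      have h7 : ‖γ t - η t‖ = ε := by
        rw [h2, hηt, add_sub_cancel_left, norm_smul, htb.norm_normal y hy, mul_one,
          Real.norm_eq_abs, hσa]
      rw [h7]
      gcongr
    have hder := (h3.hasDerivAt.sub hηd.hasDerivAt).norm_sq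
    have h8 := hmin.hasDerivAt_eq_zero hder
    simp only [Pi.sub_apply] at h8
    rw [h2, hηt, add_sub_cancel_left, real_inner_smul_left, inner_sub_right] at h8
    have hne : σ * ε ≠ 0 := by
      intro h0
      rw [h0, abs_zero] at hσa
      exact hε.ne hσa
    have h9 : inner ℝ (Γ.normal t y) (deriv γ t) = inner ℝ (Γ.normal t y) (deriv η t) := by
      have := (mul_eq_zero.mp ((mul_eq_zero.mp h8).resolve_left two_ne_zero)).resolve_left hne
      linarith
    rw [hnorm, inner_smul_right, real_inner_comm, h9, real_inner_comm, hηv]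
  · filter_upwards [hη, hI] with s hs hsI
    have hbd := (htube s hsI).frontier_thickening hε hερ
    simp only [thinDomain]
    rw [hbd]
    rcases hσ with rfl | rfl
    · exact Or.inl ⟨η s, hs, by rw [one_mul]⟩
    · exact Or.inr ⟨η s, hs, by rw [neg_one_mul]⟩
  · simp only [hηt]
  · exact hηd.add (hηn.const_smul (σ * ε))

/-- The corrections in the tangential derivatives are multiples of the sums `∑ᵢ νᵢ Wᵢⱼ`, which
vanish because the range of `W` is orthogonal to the normal. -/
theorem meanCurvature_eq {t : ℝ} {ρ : ℝ}
    (htb : IsTube (Γ.carrier t) (Γ.normal t) (Γ.closestPoint t) ρ) {y : E3}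
    (hy : y ∈ Γ.carrier t) :
    Γ.meanCurvature t y = -traceE3 (shape (Γ.normal t) (Γ.closestPoint t) y) := by
  set W := shape (Γ.normal t) (Γ.closestPoint t) y with hW
  have hd : ∀ i : Fin 3, fderiv ℝ (fun x => Γ.normal t (Γ.closestPoint t x) i) y =
      (EuclideanSpace.proj i : E3 →L[ℝ] ℝ).comp W := by
    intro i
    exact ((EuclideanSpace.proj i : E3 →L[ℝ] ℝ).hasFDerivAt.comp y
      (htb.hasFDerivAt_shape hy)).fderiv
  have h0 : ∀ j : Fin 3, ∑ i, Γ.normal t y i * W (EuclideanSpace.single j 1) i = 0 := by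
    intro j
    have := htb.inner_normal_shape hy (EuclideanSpace.single j 1)
    rw [PiLp.inner_apply] at this
    rw [← this]
    exact Finset.sum_congr rfl fun i _ => by simp [hW, mul_comm]
  have hproj : ∀ (i : Fin 3) (v : E3), (EuclideanSpace.proj i : E3 →L[ℝ] ℝ) v = v i :=
    fun _ _ => rfl
  have h1 := h0 0
  have h2 := h0 1
  have h3 := h0 2
  rw [meanCurvature, neg_inj, traceE3]
  simp only [tangentialPartial, hd, ContinuousLinearMap.comp_apply, hproj,
    Fin.sum_univ_three] at h1 h2 h3 ⊢
  simp only [Fin.isValue, if_true, Fin.reduceEq, if_false]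
  linear_combination -Γ.normal t y 0 * h1 - Γ.normal t y 1 * h2 - Γ.normal t y 2 * h3

theorem continuousOn_surfaceVelocity {t : ℝ} (ht : t ∈ Ioo 0 T) {ρ : ℝ}
    (htb : IsTube (Γ.carrier t) (Γ.normal t) (Γ.closestPoint t) ρ) :
    ContinuousOn (Γ.surfaceVelocity t) (Γ.carrier t) := by
  have h1 : ContinuousOn (fun y => inner ℝ
      (fderiv ℝ (fun z : ℝ × E3 => Γ.closestPoint z.1 z.2) (t, y) (1, 0)) (Γ.normal t y))
      (Γ.carrier t) := by
    refine ContinuousOn.inner (fun y hy => ?_) htb.continuousOn_normal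
    have h2 := (Γ.contDiffAt_closestPoint (z := (t, y)) ⟨ht, hy⟩).fderiv_right (m := 1)
      (by norm_num)
    have h3 : ContinuousAt (fun y : E3 => (t, y)) y := by fun_prop
    have h4 := ContinuousAt.comp (f := fun y : E3 => (t, y)) h2.continuousAt h3
    exact (h4.clm_apply continuousAt_const).continuousWithinAt
  exact h1.congr fun y hy => Γ.surfaceVelocity_spec ht hy

theorem exists_surfaceVelocity_bound {a b : ℝ} (ha : 0 < a) (hb : b < T) :
    ∃ C, ∀ t ∈ Icc a b, ∀ y ∈ Γ.carrier t, |Γ.surfaceVelocity t y| ≤ C := by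
  obtain ⟨C, hC⟩ := (Γ.isCompact_slab ha.le hb.le).exists_bound_of_continuousOn
    (f := fun z => fderiv ℝ (fun z : ℝ × E3 => Γ.closestPoint z.1 z.2) z (1, 0)) (by
    intro z hz
    have h1 := (Γ.contDiffAt_closestPoint (Γ.slab_subset_spaceTime ha hb hz)).fderiv_right
      (m := 1) (by norm_num)
    exact (h1.continuousAt.clm_apply continuousAt_const).continuousWithinAt)
  refine ⟨C, fun t ht y hy => ?_⟩
  have hz : (t, y) ∈ {z : ℝ × E3 | z.1 ∈ Icc a b ∧ z.2 ∈ Γ.carrier z.1} := ⟨ht, hy⟩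
  have hzS := Γ.slab_subset_spaceTime ha hb hz
  rw [Γ.surfaceVelocity_spec hzS.1 hy]
  refine (abs_real_inner_le_norm _ _).trans ?_
  rw [Γ.norm_normal hzS, mul_one]
  exact hC _ hz

end OrientedMovingSurface

/-! ### Limits of the flux and of the energy -/

theorem continuous_traceE3 : Continuous traceE3 := by
  unfold traceE3
  fun_prop

/-- The quotient of the difference of the fluxes through the two sides of the thin tube by its
width. -/
theorem abs_flux_quotient_sub_le {ε q q₁ pₒ pᵢ τ e₂ e₃ B C E₁ E₂ E₃ : ℝ} (hε : 0 < ε)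
    (hε1 : ε ≤ 1) (hq : |q| ≤ B) (hq₁ : |q₁| ≤ B) (hτ : |τ| ≤ E₁) (he₂ : |e₂| ≤ E₂)
    (he₃ : |e₃| ≤ E₃) (hp : |pₒ - (q + ε * q₁)| ≤ C * ε ^ 2)
    (hm : |pᵢ - (q - ε * q₁)| ≤ C * ε ^ 2) :
    |(2 * ε)⁻¹ * ((1 + ε * τ + ε ^ 2 * e₂ + ε ^ 3 * e₃) * pₒ -
      (1 - ε * τ + ε ^ 2 * e₂ - ε ^ 3 * e₃) * pᵢ) - (q * τ + q₁)| ≤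
      (E₃ * B + E₂ * B + (1 + E₁ + E₂ + E₃) * C) * ε := by
  set Rₒ := pₒ - (q + ε * q₁)
  set Rᵢ := pᵢ - (q - ε * q₁)
  have hE₁ : 0 ≤ E₁ := (abs_nonneg _).trans hτ
  have hE₂ : 0 ≤ E₂ := (abs_nonneg _).trans he₂
  have hE₃ : 0 ≤ E₃ := (abs_nonneg _).trans he₃
  have hB : 0 ≤ B := (abs_nonneg _).trans hq
  have hCε : 0 ≤ C * ε ^ 2 := (abs_nonneg _).trans hp
  -- The even powers of `ε` cancel between the two sides, so the polynomial part contributes only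
  -- `O(ε ^ 2)`. The remainders of `p`, of order `ε ^ 2` before division, determine the rate `ε`.
  have key : (2 * ε)⁻¹ * ((1 + ε * τ + ε ^ 2 * e₂ + ε ^ 3 * e₃) * pₒ -
      (1 - ε * τ + ε ^ 2 * e₂ - ε ^ 3 * e₃) * pᵢ) - (q * τ + q₁) =
      ε ^ 2 * (e₃ * q) + ε ^ 2 * (e₂ * q₁) + (2 * ε)⁻¹ *
      ((1 + ε * τ + ε ^ 2 * e₂ + ε ^ 3 * e₃) * Rₒ -
        (1 - ε * τ + ε ^ 2 * e₂ - ε ^ 3 * e₃) * Rᵢ) := by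
    simp only [Rₒ, Rᵢ]
    field_simp
    ring
  have hε2 : ε ^ 2 ≤ 1 := pow_le_one₀ hε.le hε1
  have hε3 : ε ^ 3 ≤ 1 := pow_le_one₀ hε.le hε1
  have t1 : |ε * τ| ≤ E₁ := by
    rw [abs_mul, abs_of_pos hε]; nlinarith [abs_nonneg τ]
  have t2 : |ε ^ 2 * e₂| ≤ E₂ := by
    rw [abs_mul, abs_of_nonneg (by positivity)]; nlinarith [abs_nonneg e₂]
  have t3 : |ε ^ 3 * e₃| ≤ E₃ := by
    rw [abs_mul, abs_of_nonneg (by positivity)]; nlinarith [abs_nonneg e₃]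
  have hεsq : ε ^ 2 ≤ ε := by nlinarith
  have a1 : |ε ^ 2 * (e₃ * q)| ≤ ε * (E₃ * B) := by
    rw [abs_mul, abs_of_nonneg (by positivity : 0 ≤ ε ^ 2), abs_mul]
    exact mul_le_mul hεsq (mul_le_mul he₃ hq (abs_nonneg _) hE₃) (by positivity) hε.le
  have a2 : |ε ^ 2 * (e₂ * q₁)| ≤ ε * (E₂ * B) := by
    rw [abs_mul, abs_of_nonneg (by positivity : 0 ≤ ε ^ 2), abs_mul]
    exact mul_le_mul hεsq (mul_le_mul he₂ hq₁ (abs_nonneg _) hE₂) (by positivity) hε.le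
  rw [abs_le] at t1 t2 t3
  have b1 : |(1 + ε * τ + ε ^ 2 * e₂ + ε ^ 3 * e₃) * Rₒ| ≤
      (1 + E₁ + E₂ + E₃) * (C * ε ^ 2) := by
    rw [abs_mul]
    refine mul_le_mul (abs_le.mpr ⟨?_, ?_⟩) hp (abs_nonneg _) (by positivity) <;> linarith
  have b2 : |(1 - ε * τ + ε ^ 2 * e₂ - ε ^ 3 * e₃) * Rᵢ| ≤
      (1 + E₁ + E₂ + E₃) * (C * ε ^ 2) := by
    rw [abs_mul]
    refine mul_le_mul (abs_le.mpr ⟨?_, ?_⟩) hm (abs_nonneg _) (by positivity) <;> linarith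
  have a3 : |(2 * ε)⁻¹ * ((1 + ε * τ + ε ^ 2 * e₂ + ε ^ 3 * e₃) * Rₒ -
        (1 - ε * τ + ε ^ 2 * e₂ - ε ^ 3 * e₃) * Rᵢ)| ≤ (1 + E₁ + E₂ + E₃) * C * ε := by
    rw [abs_mul, abs_of_pos (by positivity : 0 < (2 * ε)⁻¹), inv_mul_le_iff₀ (by positivity)]
    refine (abs_sub _ _).trans ?_
    linarith
  rw [key]
  refine (abs_add_three _ _ _).trans ?_
  linarith

namespace IsTube

variable {M : Set E3} {n P : E3 → E3} {ρ : ℝ} (h : IsTube M n P ρ)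
include h

/-- A normal expansion inside the tube extends to the boundary by continuity. -/
theorem norm_boundary_sub_le {F : Type*} [NormedAddCommGroup F] [NormedSpace ℝ F] {f : E3 → F}
    {g g₁ : E3 → F} {C r : ℝ} (hr0 : r ≠ 0) (hr : |r| < ρ)
    (hf : ContinuousOn f (closure (Metric.thickening |r| M)))
    (hexp : ∀ x ∈ Metric.thickening |r| M,
      ‖f x - (g (P x) + sdist n P x • g₁ (P x))‖ ≤ C * sdist n P x ^ 2) {y : E3} (hy : y ∈ M) :
    ‖f (y + r • n y) - (g y + r • g₁ y)‖ ≤ C * r ^ 2 := by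
  have hr1 : 0 < |r| := abs_pos.mpr hr0
  set c : ℝ → E3 := fun s => y + (s * r) • n y with hc
  have hcc : Continuous c := by fun_prop
  have hc1 : c 1 = y + r • n y := by simp [hc]
  have hin : ∀ s ∈ Ioo (0 : ℝ) 1, c s ∈ Metric.thickening |r| M ∧ P (c s) = y ∧
      sdist n P (c s) = s * r := by
    intro s hs
    have h1 : |s * r| < |r| := by
      rw [abs_mul, abs_of_pos hs.1]; nlinarith [hs.2]
    have h2 := h1.trans hr
    refine ⟨?_, h.proj_add y hy _ h2, h.sdist_add hy h2⟩
    rw [h.mem_thickening_iff, h.infDist_add hy h2]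
    exact h1
  have hev : ∀ᶠ s in 𝓝[<] (1 : ℝ), s ∈ Ioo (0 : ℝ) 1 := Ioo_mem_nhdsLT zero_lt_one
  have hct : Tendsto c (𝓝[<] 1) (𝓝 (c 1)) := (hcc.tendsto 1).mono_left nhdsWithin_le_nhds
  have hmem : c 1 ∈ closure (Metric.thickening |r| M) :=
    mem_closure_of_tendsto hct (hev.mono fun s hs => (hin s hs).1)
  have hft : Tendsto (fun s => f (c s)) (𝓝[<] 1) (𝓝 (f (c 1))) := by
    refine (hf (c 1) hmem).tendsto.comp (tendsto_nhdsWithin_iff.mpr ⟨hct, ?_⟩)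
    exact hev.mono fun s hs => subset_closure (hin s hs).1
  have hs1 : Tendsto (fun s : ℝ => s * r) (𝓝[<] 1) (𝓝 (1 * r)) :=
    ((continuous_id.mul continuous_const).tendsto 1).mono_left nhdsWithin_le_nhds
  have hlim : Tendsto (fun s => ‖f (c s) - (g y + (s * r) • g₁ y)‖) (𝓝[<] 1)
      (𝓝 ‖f (c 1) - (g y + (1 * r) • g₁ y)‖) :=
    (hft.sub (tendsto_const_nhds.add (hs1.smul_const _))).norm
  have hlim2 : Tendsto (fun s : ℝ => C * (s * r) ^ 2) (𝓝[<] 1) (𝓝 (C * (1 * r) ^ 2)) :=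
    (hs1.pow 2).const_mul C
  have hle := le_of_tendsto_of_tendsto hlim hlim2 (by
    filter_upwards [hev] with s hs
    obtain ⟨h1, h2, h3⟩ := hin s hs
    have := hexp _ h1
    rwa [h2, h3] at this)
  rwa [hc1, one_mul] at hle

end IsTube

namespace OrientedMovingSurface

variable {T : ℝ} (Γ : OrientedMovingSurface T)

theorem continuousOn_slice {F : Type*} [TopologicalSpace F] {f : ℝ → E3 → F}
    (hf : ContinuousOn (fun z : ℝ × E3 => f z.1 z.2) Γ.spaceTime) {t : ℝ} (ht : t ∈ Ioo 0 T) :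
    ContinuousOn (f t) (Γ.carrier t) :=
  hf.comp (f := fun y : E3 => (t, y)) (Continuous.prodMk_right t).continuousOn
    fun _ hy => ⟨ht, hy⟩

/-- The flux through the boundary of the thin domain, divided by its width, converges uniformly on
compact time intervals. -/
theorem exists_flux_bound {p : ℝ → ℝ → E3 → ℝ} {q q1 : ℝ → E3 → ℝ}
    (hq : ContinuousOn (fun z : ℝ × E3 => q z.1 z.2) Γ.spaceTime)
    (hq1 : ContinuousOn (fun z : ℝ × E3 => q1 z.1 z.2) Γ.spaceTime)
    (hp_cont : ∀ᶠ ε in 𝓝[>] (0 : ℝ), ∀ t ∈ Ioo 0 T,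
      ContinuousOn (p ε t) (closure (Γ.thinDomain ε t)))
    (hp : Γ.HasNormalExpansion p q q1) {a b : ℝ} (ha : 0 < a) (hb : b < T) :
    ∃ K, ∀ᶠ ε in 𝓝[>] (0 : ℝ), ∀ t ∈ Ioo a b,
      |(2 * ε)⁻¹ * (-∫ x in frontier (Γ.thinDomain ε t),
          p ε t x * Γ.thinDomainVelocity ε t x ∂μHE[2]) -
        ∫ y in Γ.carrier t,
          (q t y * Γ.meanCurvature t y - q1 t y) * Γ.surfaceVelocity t y ∂μHE[2]| ≤ K * ε := by
  obtain ⟨ρ, hρ, htube⟩ := Γ.exists_isTube ha hb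
  obtain ⟨A, hA, hArea⟩ := Γ.exists_area_bound ha hb
  obtain ⟨S, hS⟩ := Γ.exists_shape_bound ha hb
  obtain ⟨CV, hCV⟩ := Γ.exists_surfaceVelocity_bound ha hb
  have hslab := Γ.isCompact_slab ha.le hb.le
  have hsub := Γ.slab_subset_spaceTime ha hb
  obtain ⟨Bq, hBq⟩ := hslab.exists_bound_of_continuousOn (hq.mono hsub)
  obtain ⟨Bq1, hBq1⟩ := hslab.exists_bound_of_continuousOn (hq1.mono hsub)
  obtain ⟨C, hC⟩ := hp a b ha hb
  set B := max Bq Bq1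
  -- The constant of `abs_flux_quotient_sub_le` with `E₁ = 3 * S`, `E₂ = 6 * S ^ 2`, `E₃ = 6 * S ^
  -- 3`, the bounds on the trace and on the two higher coefficients of the Jacobian.
  set K₀ := 6 * S ^ 3 * B + 6 * S ^ 2 * B + (1 + 3 * S + 6 * S ^ 2 + 6 * S ^ 3) * C with hK₀
  refine ⟨|CV| * K₀ * A.toReal, ?_⟩
  filter_upwards [hp_cont, hC, Ioo_mem_nhdsGT (lt_min hρ one_pos)] with ε hpc hexp hε t ht
  obtain ⟨hε0, hε1⟩ := hε
  have hερ : ε < ρ := hε1.trans_le (min_le_left _ _)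
  have hε1 : ε ≤ 1 := hε1.le.trans (min_le_right _ _)
  have htI := Ioo_subset_Icc_self ht
  have htT : t ∈ Ioo 0 T := ⟨ha.trans ht.1, ht.2.trans hb⟩
  have htb := htube t htI
  set M := Γ.carrier t
  set n := Γ.normal t
  set V := Γ.surfaceVelocity t
  have habs : |ε| = ε := abs_of_pos hε0
  have habs' : |-ε| = ε := by rw [abs_neg, habs]
  have hVc : ContinuousOn V M := Γ.continuousOn_surfaceVelocity htT htb
  have hVp : ∀ y ∈ M, Γ.thinDomainVelocity ε t (y + ε • n y) = V y := by
    intro y hy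
    have := Γ.thinDomainVelocity_eq ha hb htube ht hy hε0 hερ (σ := 1) (Or.inl rfl)
    rwa [one_mul, one_mul] at this
  have hVm : ∀ y ∈ M, Γ.thinDomainVelocity ε t (y + (-ε) • n y) = -V y := by
    intro y hy
    have := Γ.thinDomainVelocity_eq ha hb htube ht hy hε0 hερ (σ := -1) (Or.inr rfl)
    rwa [neg_one_mul, neg_one_mul] at this
  have hfr := htb.frontier_thickening hε0 hερ
  have hpfr : ContinuousOn (p ε t) (frontier (Metric.thickening ε M)) :=
    (hpc t htT).mono frontier_subset_closure
  rw [hfr] at hpfr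
  have hpp := hpfr.mono subset_union_left
  have hpm := hpfr.mono subset_union_right
  -- The boundary velocity is plus or minus `V ∘ π` on each sheet, which supplies its continuity
  -- there.
  have himg : ∀ r : ℝ, |r| < ρ → ContinuousOn (fun x => V (Γ.closestPoint t x))
      ((fun y => y + r • n y) '' M) := by
    intro r hr
    refine hVc.comp (htb.continuousOn_proj.mono ?_) fun x _ => htb.proj_mem x
    rintro _ ⟨y, hy, rfl⟩
    rw [htb.mem_thickening_iff, htb.infDist_add hy hr]
    exact hr
  have hint := htb.setIntegral_frontier hε0 hερ
    (f := fun x => p ε t x * Γ.thinDomainVelocity ε t x)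
    (hpp.mul ((himg ε (by rwa [habs])).congr (by
      rintro _ ⟨y, hy, rfl⟩
      simp only
      rw [hVp y hy, htb.proj_add y hy ε (by rwa [habs])])))
    (hpm.mul ((himg (-ε) (by rwa [habs'])).neg.congr (by
      rintro _ ⟨y, hy, rfl⟩
      simp only [Pi.neg_apply]
      rw [hVm y hy, htb.proj_add y hy (-ε) (by rwa [habs'])])))
  set J := tubeJacobian n (Γ.closestPoint t)
  have hint' : ∫ x in frontier (Γ.thinDomain ε t),
      p ε t x * Γ.thinDomainVelocity ε t x ∂μHE[2] =
      ∫ y in M, (J ε y * p ε t (y + ε • n y) - J (-ε) y * p ε t (y + (-ε) • n y)) * V y ∂μHE[2] := by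
    refine hint.trans (setIntegral_congr_fun htb.measurableSet fun y hy => ?_)
    rw [hVp y hy, hVm y hy]; ring
  have hqc : ContinuousOn (q t) M := Γ.continuousOn_slice hq htT
  have hq1c : ContinuousOn (q1 t) M := Γ.continuousOn_slice hq1 htT
  have hHc : ContinuousOn (Γ.meanCurvature t) M :=
    ((continuous_traceE3.comp_continuousOn htb.continuousOn_shape).neg).congr
      fun y hy => Γ.meanCurvature_eq htb hy
  have hi1 : IntegrableOn (fun y => (J ε y * p ε t (y + ε • n y) -
      J (-ε) y * p ε t (y + (-ε) • n y)) * V y) M μHE[2] := by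
    refine htb.integrableOn ((ContinuousOn.sub ?_ ?_).mul hVc)
    · exact (htb.continuousOn_tubeJacobian ε).mul
        (hpp.comp (htb.continuousOn_displace ε) (mapsTo_image _ _))
    · exact (htb.continuousOn_tubeJacobian (-ε)).mul
        (hpm.comp (htb.continuousOn_displace (-ε)) (mapsTo_image _ _))
  have hi2 : IntegrableOn (fun y => (q t y * Γ.meanCurvature t y - q1 t y) * V y) M μHE[2] :=
    htb.integrableOn (((hqc.mul hHc).sub hq1c).mul hVc)
  have hpt : ∀ y ∈ M, ‖(-(2 * ε)⁻¹) * ((J ε y * p ε t (y + ε • n y) -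
      J (-ε) y * p ε t (y + (-ε) • n y)) * V y) -
      (q t y * Γ.meanCurvature t y - q1 t y) * V y‖ ≤ |CV| * (K₀ * ε) := by
    intro y hy
    have hSy : ‖shape n (Γ.closestPoint t) y‖ ≤ S := hS t htI y hy
    obtain ⟨e₂, e₃, he₂, he₃, hdet⟩ := exists_det_id_add_smul hSy
    have hcl := hpc t htT
    have hex := hexp t htI
    have b1 := htb.norm_boundary_sub_le (f := p ε t) (g := q t) (g₁ := q1 t) (C := C) (r := ε)
      hε0.ne' (by rwa [habs]) (by rw [habs]; exact hcl) (by rw [habs]; exact hex) hy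
    have b2 := htb.norm_boundary_sub_le (f := p ε t) (g := q t) (g₁ := q1 t) (C := C) (r := -ε)
      (neg_ne_zero.mpr hε0.ne') (by rwa [habs']) (by rw [habs']; exact hcl)
      (by rw [habs']; exact hex) hy
    rw [Real.norm_eq_abs, smul_eq_mul] at b1 b2
    rw [neg_mul, ← sub_eq_add_neg, neg_sq] at b2
    have hzK : (t, y) ∈ {z : ℝ × E3 | z.1 ∈ Icc a b ∧ z.2 ∈ Γ.carrier z.1} := ⟨htI, hy⟩
    have key := abs_flux_quotient_sub_le hε0 hε1 ((hBq _ hzK).trans (le_max_left Bq Bq1))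
      ((hBq1 _ hzK).trans (le_max_right Bq Bq1)) (abs_traceE3_le hSy) he₂ he₃ b1 b2
    have hJp : J ε y = 1 + ε * traceE3 (shape n (Γ.closestPoint t) y) + ε ^ 2 * e₂ + ε ^ 3 * e₃ :=
      hdet ε
    have hJm : J (-ε) y =
        1 - ε * traceE3 (shape n (Γ.closestPoint t) y) + ε ^ 2 * e₂ - ε ^ 3 * e₃ := by
      rw [show J (-ε) y = _ from hdet (-ε)]; ring
    rw [← hJp, ← hJm] at key
    rw [Γ.meanCurvature_eq htb hy, Real.norm_eq_abs]
    have e : (-(2 * ε)⁻¹) * ((J ε y * p ε t (y + ε • n y) -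
      J (-ε) y * p ε t (y + (-ε) • n y)) * V y) -
      (q t y * -traceE3 (shape n (Γ.closestPoint t) y) - q1 t y) * V y =
      -(V y * ((2 * ε)⁻¹ * (J ε y * p ε t (y + ε • n y) - J (-ε) y * p ε t (y + (-ε) • n y)) -
        (q t y * traceE3 (shape n (Γ.closestPoint t) y) + q1 t y))) := by ring
    rw [e, abs_neg, abs_mul]
    exact mul_le_mul ((hCV t htI y hy).trans (le_abs_self _)) key (abs_nonneg _) (abs_nonneg _)
  rw [hint', mul_neg, ← neg_mul, ← integral_const_mul, ← integral_sub (hi1.const_mul _) hi2]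
  have hfin := norm_setIntegral_le_of_norm_le_const htb.area_lt_top hpt
  rw [Real.norm_eq_abs] at hfin
  refine hfin.trans ?_
  have hAr : (μHE[2] : Measure E3).real M ≤ A.toReal :=
    ENNReal.toReal_mono hA (hArea t htI)
  -- The constant `C` carries no sign assumption; nonnegativity of the bound is read off from the
  -- pointwise estimate at one point.
  obtain ⟨y₀, hy₀⟩ := htb.nonempty
  have hnn := (norm_nonneg _).trans (hpt y₀ hy₀)
  calc _ ≤ |CV| * (K₀ * ε) * A.toReal := mul_le_mul_of_nonneg_left hAr hnn
    _ = _ := by ring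

/-- Since `u = v ∘ π + O(ε)` with `v` bounded on the compact surface, the energy densities differ by
`O(ε)`; the first-order coefficient `v1` enters only through its bound. -/
theorem tendsto_energy {u : ℝ → ℝ → E3 → E3} {v v1 : ℝ → E3 → E3}
    (hv : ContinuousOn (fun z : ℝ × E3 => v z.1 z.2) Γ.spaceTime)
    (hv1 : ContinuousOn (fun z : ℝ × E3 => v1 z.1 z.2) Γ.spaceTime)
    (hu_cont : ∀ᶠ ε in 𝓝[>] (0 : ℝ), ∀ t ∈ Ioo 0 T, ContinuousOn (u ε t) (Γ.thinDomain ε t))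
    (hu : Γ.HasNormalExpansion u v v1) {t : ℝ} (ht : t ∈ Ioo 0 T) :
    Tendsto (fun ε => (2 * ε)⁻¹ * ∫ x in Γ.thinDomain ε t, ‖u ε t x‖ ^ 2 / 2) (𝓝[>] 0)
      (𝓝 (∫ y in Γ.carrier t, ‖v t y‖ ^ 2 / 2 ∂μHE[2])) := by
  obtain ⟨ρ, hρ, htube⟩ := Γ.exists_isTube ht.1 ht.2
  have htb := htube t ⟨le_rfl, le_rfl⟩
  obtain ⟨C, hC⟩ := hu t t ht.1 ht.2
  have hvc : ContinuousOn (v t) (Γ.carrier t) := Γ.continuousOn_slice hv ht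
  have hv1c : ContinuousOn (v1 t) (Γ.carrier t) := Γ.continuousOn_slice hv1 ht
  obtain ⟨B, hB⟩ := htb.isCompact.exists_bound_of_continuousOn hvc
  obtain ⟨B1, hB1⟩ := htb.isCompact.exists_bound_of_continuousOn hv1c
  refine htb.tendsto_setIntegral_thickening (f := fun ε x => ‖u ε t x‖ ^ 2 / 2)
    (g := fun y => ‖v t y‖ ^ 2 / 2) ((hvc.norm.pow 2).div_const 2) (fun y _ => by positivity) ?_
    -- The factors bound `‖u - v‖ / ε` and `‖u‖ + ‖v‖` respectively, for `ε ≤ 1`.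
    (C := (B1 + |C|) * (2 * B + B1 + |C|) / 2) ?_
  · filter_upwards [hu_cont] with ε hε
    exact ((hε t ht).norm.pow 2).div_const 2
  · filter_upwards [hC, Ioo_mem_nhdsGT (lt_min hρ one_pos)] with ε hexp hε x hx
    obtain ⟨hε0, hε1⟩ := hε
    have hερ : ε < ρ := hε1.trans_le (min_le_left _ _)
    have hε1 : ε ≤ 1 := hε1.le.trans (min_le_right _ _)
    have h1 := hexp t ⟨le_rfl, le_rfl⟩ x hx
    have hx' : Metric.infDist x (Γ.carrier t) < ε := htb.mem_thickening_iff.mp hx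
    have hd : |Γ.signedDist t x| < ε := by
      rw [htb.infDist_eq (hx'.trans hερ)] at hx'
      exact hx'
    set d := Γ.signedDist t x
    set y := Γ.closestPoint t x
    have hy : y ∈ Γ.carrier t := htb.proj_mem x
    have h2 := hB y hy
    have h3 := hB1 y hy
    have hB1n : 0 ≤ B1 := (norm_nonneg _).trans h3
    have hdsq : d ^ 2 ≤ ε := by
      rw [← sq_abs]
      have := abs_nonneg d
      nlinarith
    have h4 : ‖u ε t x - v t y‖ ≤ (B1 + |C|) * ε := by
      have e : u ε t x - v t y = (u ε t x - (v t y + d • v1 t y)) + d • v1 t y := by abel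
      rw [e]
      refine (norm_add_le _ _).trans ?_
      rw [norm_smul, Real.norm_eq_abs]
      have h5 : C * d ^ 2 ≤ |C| * ε :=
        mul_le_mul (le_abs_self C) hdsq (sq_nonneg _) (abs_nonneg _)
      have h6 : |d| * ‖v1 t y‖ ≤ ε * B1 := mul_le_mul hd.le h3 (norm_nonneg _) hε0.le
      linarith
    have h5 : ‖u ε t x‖ ≤ B + B1 + |C| := by
      have h6 : ‖u ε t x‖ ≤ ‖v t y‖ + ‖u ε t x - v t y‖ := norm_le_insert' _ _
      have h7 : (B1 + |C|) * ε ≤ B1 + |C| := mul_le_of_le_one_right (by positivity) hε1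
      linarith
    have h6 : |‖u ε t x‖ - ‖v t y‖| ≤ (B1 + |C|) * ε := (abs_norm_sub_norm_le _ _).trans h4
    have e : ‖u ε t x‖ ^ 2 / 2 - ‖v t y‖ ^ 2 / 2 =
        (‖u ε t x‖ - ‖v t y‖) * (‖u ε t x‖ + ‖v t y‖) / 2 := by ring
    rw [e, abs_div, abs_mul, abs_of_nonneg (by positivity : 0 ≤ ‖u ε t x‖ + ‖v t y‖),
      abs_of_pos (two_pos : (0 : ℝ) < 2)]
    have h7 : ‖u ε t x‖ + ‖v t y‖ ≤ 2 * B + B1 + |C| := by linarith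
    have h8 : |‖u ε t x‖ - ‖v t y‖| * (‖u ε t x‖ + ‖v t y‖) ≤
        (B1 + |C|) * ε * (2 * B + B1 + |C|) := mul_le_mul h6 h7 (by positivity) (by positivity)
    linarith

end OrientedMovingSurface

/-- The thin width limit of the energy identity of the Euler equations. The fields `u ε`, `p ε`
are the velocity and the pressure in the thin domain of width parameter `ε`. -/
theorem theorem5p3 (T : ℝ) (Γ : OrientedMovingSurface T)
    (u : ℝ → ℝ → E3 → E3) (p : ℝ → ℝ → E3 → ℝ)
    (v v1 : ℝ → E3 → E3) (q q1 : ℝ → E3 → ℝ)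
    (hv : ContinuousOn (fun z : ℝ × E3 => v z.1 z.2) Γ.spaceTime)
    (hv1 : ContinuousOn (fun z : ℝ × E3 => v1 z.1 z.2) Γ.spaceTime)
    (hq : ContinuousOn (fun z : ℝ × E3 => q z.1 z.2) Γ.spaceTime)
    (hq1 : ContinuousOn (fun z : ℝ × E3 => q1 z.1 z.2) Γ.spaceTime)
    (hu_cont : ∀ᶠ ε in 𝓝[>] (0 : ℝ), ∀ t ∈ Ioo 0 T, ContinuousOn (u ε t) (Γ.thinDomain ε t))
    (hp_cont : ∀ᶠ ε in 𝓝[>] (0 : ℝ), ∀ t ∈ Ioo 0 T,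
      ContinuousOn (p ε t) (closure (Γ.thinDomain ε t)))
    (hu : Γ.HasNormalExpansion u v v1) (hp : Γ.HasNormalExpansion p q q1)
    (henergy : ∀ᶠ ε in 𝓝[>] (0 : ℝ), Γ.BulkEnergyIdentity ε (u ε) (p ε)) :
    Γ.SurfaceEnergyIdentity v q q1 := by
  intro t₀ ht₀
  -- A time interval around `t₀` with closure inside `(0, T)`, where the flux estimate is uniform.
  have ha : 0 < t₀ / 2 := half_pos ht₀.1
  have hb : (t₀ + T) / 2 < T := by linarith [ht₀.2]
  have hmem : t₀ ∈ Ioo (t₀ / 2) ((t₀ + T) / 2) := ⟨by linarith [ht₀.1], by linarith [ht₀.2]⟩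
  have hsub : ∀ t ∈ Ioo (t₀ / 2) ((t₀ + T) / 2), t ∈ Ioo 0 T :=
    fun t ht => ⟨ha.trans ht.1, ht.2.trans hb⟩
  obtain ⟨K, hK⟩ := Γ.exists_flux_bound hq hq1 hp_cont hp ha hb
  -- Differentiability of the surface energy is part of the conclusion here: it is inherited from
  -- the rescaled bulk energies.
  refine hasDerivAt_of_tendstoUniformlyOn (l := 𝓝[>] (0 : ℝ)) (isOpen_Ioo)
    (f := fun ε t => (2 * ε)⁻¹ * ∫ x in Γ.thinDomain ε t, ‖u ε t x‖ ^ 2 / 2)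
    (f' := fun ε t => (2 * ε)⁻¹ * (-∫ x in frontier (Γ.thinDomain ε t),
      p ε t x * Γ.thinDomainVelocity ε t x ∂μHE[2]))
    (g' := fun t => ∫ y in Γ.carrier t,
      (q t y * Γ.meanCurvature t y - q1 t y) * Γ.surfaceVelocity t y ∂μHE[2])
    ?_ ?_ (fun t ht => Γ.tendsto_energy hv hv1 hu_cont hu (hsub t ht)) hmem
  · rw [Metric.tendstoUniformlyOn_iff]
    intro δ hδ
    have hKε : Tendsto (fun ε : ℝ => K * ε) (𝓝[>] 0) (𝓝 0) := by
      have hc : Continuous fun ε : ℝ => K * ε := by fun_prop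
      have := (hc.tendsto 0).mono_left (nhdsWithin_le_nhds (s := Ioi 0))
      simpa using this
    filter_upwards [hK, hKε.eventually_lt_const hδ] with ε h1 h2 t ht
    rw [dist_comm, Real.dist_eq]
    exact (h1 t ht).trans_lt h2
  · filter_upwards [henergy] with ε hε t ht
    exact (hε t (hsub t ht)).const_mul _
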